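/- A seller sets one of two prices $0\le p_1<p_2\le 1$ at each of $T$ time steps. Setting price $p_k$ at time $t$ yields an observed demand $D_t(p_k)\in[0,1]$; the demands are i.i.d. over time with an arbitrary law $\nu_k$ on $[0,1]$ of mean $\mu_k$. With a price protection period of length $M$, the customer of time $t$ finally pays the lowest price set during the time steps $t,t+1,\dots,\min\{t+M,T\}$. A (possibly randomized, non-anticipatory) policy $\pi$ knows $T,M,p_1,p_2$ but not $\nu_1,\nu_2$, and picks the index $i_t\in\{1,2\}$ from the past prices, the past observed demands and independent randomization. Its regret is $$\mathrm{Regret}(\pi)=T\max\{p_1\mu_1,p_2\mu_2\}-\mathbb E\Big[\sum_{t=1}^T \min\{p_{i_t},\dots,p_{i_{\min\{t+M,T\}}}\}\,D_t(p_{i_t})\Big],$$ and the minimax optimal regret is $R^*(T,M)=\inf_\pi\sup\mathrm{Regret}(\pi)$, where the supremum is over all prices $0\le p_1<p_2\le1$ and all demand laws $\nu_1,\nu_2$ on $[0,1]$. Theorem. $R^*(T,M)=\tilde\Theta\big(\sqrt T+\min\{M,T^{2/3}\}\big)$. Precisely, there are absolute constants $c,C>0$ such that for all integers $T\ge3$ and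 $M\ge0$ $$c\,\big(\sqrt T+\min\{M,T^{2/3}\}\big)\le R^*(T,M)\le C\,\big(\sqrt T+\min\{M\log\log T,\;T^{2/3}\}\big).$$ Consequently there are three phases: for all $\kappa,\kappa_1,\kappa_2>0$ there are constants $c,C>0$, depending only on these, such that for all integers $T\ge 3$ and $M\ge 0$ - if $M\le\kappa\sqrt T$, then $c\sqrt T\le R^*(T,M)\le C\sqrt T\log\log T$; - if $\kappa_1\sqrt T\le M\le\kappa_2T^{2/3}$, then $cM\le R^*(T,M)\le CM\log\log T$; - if $M\ge\kappa T^{2/3}$, then $cT^{2/3}\le R^*(T,M)\le CT^{2/3}$. -/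

import Mathlib

open MeasureTheory

namespace PriceProtection

/-- A pair of candidate prices `0 ≤ p₁ < p₂ ≤ 1`; `val 0` is `p₁` and `val 1` is `p₂`. -/
structure PricePair where
  val : Fin 2 → ℝ
  mem : ∀ k, val k ∈ Set.Icc (0 : ℝ) 1
  lt : val 0 < val 1

/-- A demand environment: the law on `[0,1]` of the demand under each of the two prices. -/
abbrev Demand : Type := Fin 2 → ProbabilityMeasure unitInterval

/-- Mean demand `μ k` under price `k`. -/
noncomputable def meanDemand (ν : Demand) (k : Fin 2) : ℝ :=
  ∫ x : unitInterval, (x : ℝ) ∂(ν k : Measure unitInterval)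

/-- Expected one-step reward `p k * μ k` of price `k`. -/
noncomputable def meanReward (p : PricePair) (ν : Demand) (k : Fin 2) : ℝ :=
  p.val k * meanDemand ν k

/-- A possibly randomized non-anticipatory pricing policy. It draws a private random seed,
independent of the demands, and at each time step picks a price from the seed and the history, that
is, the past prices (recorded by their indices) and the demands observed under them. Past refunds
are functions of this history, so recording them would add nothing. Time steps are numbered from
`0`, so that the history at time step `t` has length `t`. -/
structure Policy where
  Seed : Type
  [seedMeasurable : MeasurableSpace Seed]
  seedLaw : Measure Seed
  [seedProb : IsProbabilityMeasure seedLaw]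
  choose : (t : ℕ) → Seed × (Fin t → Fin 2 × unitInterval) → Fin 2
  measurable_choose : ∀ t, Measurable (choose t)

attribute [instance] Policy.seedMeasurable Policy.seedProb

/-- The history before time step `t`, when the policy uses the seed `ω` and `D s k` is the demand
at time step `s` under price `k`. Only the demand under the price actually set is revealed. -/
def history (π : Policy) (ω : π.Seed) (D : ℕ → Fin 2 → unitInterval) :
    (t : ℕ) → (Fin t → Fin 2 × unitInterval)
  | 0 => Fin.elim0
  | t + 1 =>
    let h := history π ω D t
    let k := π.choose t (ω, h)
    Fin.snoc (α := fun _ => Fin 2 × unitInterval) h (k, D t k)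

/-- Index of the price that is set at time step `t`. -/
def chosen (π : Policy) (ω : π.Seed) (D : ℕ → Fin 2 → unitInterval) (t : ℕ) : Fin 2 :=
  π.choose t (ω, history π ω D t)

/-- A table of demands over a horizon of length `T`, continued by zero demand. -/
noncomputable def extend {T : ℕ} (D : Fin T → Fin 2 → unitInterval) : ℕ → Fin 2 → unitInterval :=
  fun t k => if h : t < T then D ⟨t, h⟩ k else 0

/-- Final payment per unit of the customer of time step `t`: the smallest price set during the time
steps `t, …, t + M` that lie within the horizon. -/
noncomputable def finalPrice {T : ℕ} (M : ℕ) (p : PricePair) (i : Fin T → Fin 2) (t : Fin T) : ℝ :=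
  (Finset.univ.filter (fun s : Fin T => t ≤ s ∧ (s : ℕ) ≤ t + M)).inf'
    ⟨t, by simp⟩ (fun s => p.val (i s))

/-- Total revenue, after all refunds, over a horizon of length `T` for a protection period `M`. -/
noncomputable def revenue {T : ℕ} (M : ℕ) (p : PricePair) (π : Policy)
    (ω : π.Seed) (D : Fin T → Fin 2 → unitInterval) : ℝ :=
  let i : Fin T → Fin 2 := fun t => chosen π ω (extend D) t
  ∑ t : Fin T, finalPrice M p i t * (D t (i t) : ℝ)

/-- Law of the demand table: demands are independent, with law `ν k` under price `k`. -/
noncomputable def demandLaw (T : ℕ) (ν : Demand) : Measure (Fin T → Fin 2 → unitInterval) :=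
  Measure.pi fun _ => Measure.pi fun k => (ν k : Measure unitInterval)

/-- Expected total revenue, over the demands and the seed of the policy. -/
noncomputable def expectedRevenue (T M : ℕ) (p : PricePair) (ν : Demand) (π : Policy) : ℝ :=
  ∫ x : π.Seed × (Fin T → Fin 2 → unitInterval), revenue M p π x.1 x.2
    ∂(π.seedLaw.prod (demandLaw T ν))

/-- Expected regret against the better of the two prices. -/
noncomputable def regret (T M : ℕ) (p : PricePair) (ν : Demand) (π : Policy) : ℝ :=
  T * max (meanReward p ν 0) (meanReward p ν 1) - expectedRevenue T M p ν π

/-- Minimax optimal regret: the infimum over policies of the supremum of the regret over all price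
pairs and demand laws. The policy is told the prices (as well as `T` and `M`), but not the demand
laws, hence `π` is a function of the price pair. The infimum and the supremum are over nonempty
sets of reals in `[-T, T]`, see `abs_regret_le`. -/
noncomputable def optRegret (T M : ℕ) : ℝ :=
  ⨅ π : PricePair → Policy, ⨆ e : PricePair × Demand, regret T M e.1 e.2 (π e.1)

instance (T : ℕ) (ν : Demand) : IsProbabilityMeasure (demandLaw T ν) := by
  unfold demandLaw; infer_instance

theorem finalPrice_mem {T : ℕ} (M : ℕ) (p : PricePair) (i : Fin T → Fin 2) (t : Fin T) :
    finalPrice M p i t ∈ Set.Icc (0 : ℝ) 1 := by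
  refine ⟨Finset.le_inf' _ _ fun s _ => (p.mem _).1, ?_⟩
  exact (Finset.inf'_le (fun s => p.val (i s)) (b := t) (by simp)).trans (p.mem _).2

theorem revenue_mem {T : ℕ} (M : ℕ) (p : PricePair) (π : Policy)
    (ω : π.Seed) (D : Fin T → Fin 2 → unitInterval) :
    revenue M p π ω D ∈ Set.Icc (0 : ℝ) T := by
  refine ⟨Finset.sum_nonneg fun t _ => mul_nonneg (finalPrice_mem ..).1 (D _ _).2.1, ?_⟩
  refine (Finset.sum_le_card_nsmul _ _ 1 fun t _ =>
    mul_le_one₀ (finalPrice_mem ..).2 (D _ _).2.1 (D _ _).2.2).trans ?_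
  simp

theorem abs_regret_le (T M : ℕ) (p : PricePair) (ν : Demand) (π : Policy) :
    |regret T M p ν π| ≤ T := by
  have h0 : 0 ≤ expectedRevenue T M p ν π :=
    integral_nonneg fun x => (revenue_mem M p π x.1 x.2).1
  have h1 : ‖expectedRevenue T M p ν π‖ ≤ T := by
    refine (norm_integral_le_of_norm_le_const (C := T) (Filter.Eventually.of_forall fun x => ?_)).trans
      (by simp)
    have := revenue_mem M p π x.1 x.2
    rw [Real.norm_eq_abs, abs_of_nonneg this.1]
    exact this.2
  have h2 : ∀ k, meanReward p ν k ∈ Set.Icc (0 : ℝ) 1 := by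
    intro k
    have a0 : 0 ≤ meanDemand ν k := integral_nonneg fun x => x.2.1
    have a1 : ‖meanDemand ν k‖ ≤ 1 := by
      refine (norm_integral_le_of_norm_le_const (C := 1)
        (Filter.Eventually.of_forall fun x => ?_)).trans (by simp)
      rw [Real.norm_eq_abs, abs_of_nonneg x.2.1]
      exact x.2.2
    rw [Real.norm_eq_abs, abs_of_nonneg a0] at a1
    exact ⟨mul_nonneg (p.mem k).1 a0, mul_le_one₀ (p.mem k).2 a0 a1⟩
  rw [Real.norm_eq_abs, abs_of_nonneg h0] at h1
  have h3 : 0 ≤ max (meanReward p ν 0) (meanReward p ν 1) := le_max_of_le_left (h2 0).1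
  have h4 : max (meanReward p ν 0) (meanReward p ν 1) ≤ 1 := max_le (h2 0).2 (h2 1).2
  have h5 : (0 : ℝ) ≤ T := Nat.cast_nonneg T
  rw [regret, abs_le]
  constructor <;> nlinarith

end PriceProtection

/-!
The minimax regret of the two-price problem with price protection is bounded on both sides.

The regret is the expectation of a pathwise `loss` (`regret_eq_integral_loss`): the gap between the
mean rewards of the better price and of the price set, summed over time, plus the refunds. This
holds because the price at time `t` is independent of the demand at time `t`, which is expressed by
the invariance of the demand law under resampling row `t` of the demand table.

*Lower bound.* The prices are `1/2` and `1`; the demand is `1` under the lower price, and `3/4` or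
`1/4` with probabilities `1/2 ± β` under the higher one. With `β` of order `1 / √n`, the two signs
of `β` cannot be told apart until the higher price has been used `n` times: the Hellinger affinity
of the two laws of the history loses a factor `√(1 - 4 β ^ 2)` for each use
(`pow_le_sqrt_add_sqrt`). For `n = T / 2` this gives regret of order `√T`. Let now `n ≤ M` be of
order `min M (T ^ (2/3))`. If the higher price is used fewer than `n` times in the first half, the
policy loses order `T / √n ≥ n` when that price is better. Otherwise, when the lower price is
better, it either returns to the lower price, which entails at least `n` refunds of constant size
(`forall_eq_one_or_le_card_refunded`), or sets the higher price throughout the second half, which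
again costs order `T / √n ≥ n`.

*Upper bound.* A policy explores in phases, each of which uses the lower and then the higher price
equally often, and commits to a price as soon as the rewards within one phase differ by more than a
tolerance. Refunds arise only where a phase starts, so that there are at most `M` of them per phase
and at most as many as there are exploration steps (`card_refunded_le_mul`,
`card_refunded_le_start`). Hoeffding's inequality bounds the risk of a wrong commitment and of
exploring too long (`regret_policy_le`). A single phase of size of order `T ^ (2/3)` gives regret of
order `T ^ (2/3)` for every `M`. Phases of sizes proportional to `T * exp (-(4/3) ^ j)`, for `j`
decreasing to `0` from order `log (log T)`, give `√T + M * log (log T)`. With exponents that double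
from phase to phase, each phase would cost `√T` and a logarithmic factor for the tolerance; the
smaller ratio `4/3` absorbs this factor and makes the costs of the phases sum to order `√T`.
-/

namespace PriceProtection

/-! ### The play of a policy -/

theorem history_congr (π : Policy) (ω : π.Seed) {D D' : ℕ → Fin 2 → unitInterval} {t : ℕ}
    (h : ∀ s < t, D s = D' s) : history π ω D t = history π ω D' t := by
  induction t with
  | zero => rfl
  | succ t ih =>
    simp only [history, ih fun s hs => h s (hs.trans (Nat.lt_succ_self t)),
      h t (Nat.lt_succ_self t)]

theorem chosen_congr (π : Policy) (ω : π.Seed) {D D' : ℕ → Fin 2 → unitInterval} {t : ℕ}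
    (h : ∀ s < t, D s = D' s) : chosen π ω D t = chosen π ω D' t := by
  rw [chosen, chosen, history_congr π ω h]

theorem history_succ (π : Policy) (ω : π.Seed) (D : ℕ → Fin 2 → unitInterval) (t : ℕ) :
    history π ω D (t + 1) = Fin.snoc (α := fun _ => Fin 2 × unitInterval) (history π ω D t)
      (chosen π ω D t, D t (chosen π ω D t)) := rfl

theorem history_apply (π : Policy) (ω : π.Seed) (D : ℕ → Fin 2 → unitInterval) (t : ℕ)
    (s : Fin t) : history π ω D t s = (chosen π ω D s, D s (chosen π ω D s)) := by
  induction t with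
  | zero => exact s.elim0
  | succ t ih =>
    rw [history_succ]
    refine Fin.lastCases ?_ (fun s => ?_) s
    · simp
    · simp [ih]

theorem measurable_apply_comp {α β : Type*} [MeasurableSpace α] [MeasurableSpace β]
    {f : α → Fin 2 → β} {k : α → Fin 2} (hf : Measurable f) (hk : Measurable k) :
    Measurable fun a => f a (k a) := by
  have : Measurable (fun p : Fin 2 × (Fin 2 → β) => p.2 p.1) :=
    measurable_from_prod_countable_right fun k => measurable_pi_apply k
  exact this.comp (hk.prodMk hf)

theorem measurable_snoc {α β : Type*} [MeasurableSpace α] [MeasurableSpace β] {t : ℕ}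
    {f : α → Fin t → β} {g : α → β} (hf : Measurable f) (hg : Measurable g) :
    Measurable fun a => Fin.snoc (α := fun _ => β) (f a) (g a) := by
  refine measurable_pi_iff.2 fun s => ?_
  refine Fin.lastCases ?_ (fun s => ?_) s
  · simpa using hg
  · simpa [Function.comp_def] using (measurable_pi_apply s).comp hf

theorem measurable_history (π : Policy) (t : ℕ) :
    Measurable fun x : π.Seed × (ℕ → Fin 2 → unitInterval) => history π x.1 x.2 t := by
  induction t with
  | zero => exact measurable_const
  | succ t ih =>
    have hk : Measurable fun x : π.Seed × (ℕ → Fin 2 → unitInterval) => chosen π x.1 x.2 t :=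
      (π.measurable_choose t).comp (measurable_fst.prodMk ih)
    have hD : Measurable fun x : π.Seed × (ℕ → Fin 2 → unitInterval) => x.2 t :=
      (measurable_pi_apply t).comp measurable_snd
    exact measurable_snoc ih (hk.prodMk (measurable_apply_comp hD hk))

theorem measurable_extend {T : ℕ} :
    Measurable (extend : (Fin T → Fin 2 → unitInterval) → ℕ → Fin 2 → unitInterval) := by
  refine measurable_pi_iff.2 fun t => measurable_pi_iff.2 fun k => ?_
  unfold extend
  split_ifs
  · fun_prop
  · exact measurable_const

theorem measurable_history_extend (π : Policy) (T t : ℕ) :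
    Measurable fun x : π.Seed × (Fin T → Fin 2 → unitInterval) =>
      history π x.1 (extend x.2) t :=
  (measurable_history π t).comp (measurable_fst.prodMk (measurable_extend.comp measurable_snd))

theorem measurable_chosen_extend (π : Policy) (T t : ℕ) :
    Measurable fun x : π.Seed × (Fin T → Fin 2 → unitInterval) =>
      chosen π x.1 (extend x.2) t :=
  (π.measurable_choose t).comp (measurable_fst.prodMk (measurable_history_extend π T t))

theorem extend_update_of_ne {T : ℕ} (D : Fin T → Fin 2 → unitInterval) (t : Fin T)
    (x : Fin 2 → unitInterval) {s : ℕ} (h : s ≠ t) :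
    extend (Function.update D t x) s = extend D s := by
  funext k
  unfold extend
  split_ifs with hs
  · rw [Function.update_of_ne]
    exact fun h' => h (by rw [← h'])
  · rfl

theorem extend_apply {T : ℕ} (D : Fin T → Fin 2 → unitInterval) (t : Fin T) :
    extend D t = D t := by
  funext k
  simp [extend]

/-! ### Resampling one row of the demand table -/

/-- A product of probability measures is invariant under resampling one coordinate. -/
theorem measurePreserving_update {ι : Type*} [Fintype ι] [DecidableEq ι] {α : ι → Type*}
    [∀ i, MeasurableSpace (α i)] (μ : ∀ i, Measure (α i)) [∀ i, IsProbabilityMeasure (μ i)]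
    (i : ι) :
    MeasurePreserving (fun x : (∀ i, α i) × α i => Function.update x.1 i x.2)
      ((Measure.pi μ).prod (μ i)) (Measure.pi μ) := by
  have hm : Measurable fun x : (∀ i, α i) × α i => Function.update x.1 i x.2 := by
    refine measurable_pi_iff.2 fun j => ?_
    by_cases h : j = i
    · subst h
      simpa using measurable_snd
    · simpa [Function.update_of_ne h, Function.comp_def] using
        (measurable_pi_apply j).comp measurable_fst
  refine ⟨hm, (Measure.pi_eq fun s hs => ?_).symm⟩
  rw [Measure.map_apply hm (MeasurableSet.univ_pi hs)]
  have : (fun x : (∀ i, α i) × α i => Function.update x.1 i x.2) ⁻¹' Set.univ.pi s =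
      (Set.univ.pi (Function.update s i Set.univ)) ×ˢ s i := by
    ext ⟨f, y⟩
    simp only [Set.mem_preimage, Set.mem_pi, Set.mem_univ, true_imp_iff, Set.mem_prod]
    constructor
    · intro h
      refine ⟨fun j => ?_, by simpa using h i⟩
      by_cases hj : j = i
      · subst hj; simp
      · simpa [Function.update_of_ne hj] using h j
    · rintro ⟨h, hy⟩ j
      by_cases hj : j = i
      · subst hj; simpa using hy
      · simpa [Function.update_of_ne hj] using h j
  rw [this, Measure.prod_prod, Measure.pi_pi, ← Finset.prod_erase_mul _ _ (Finset.mem_univ i),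
    ← Finset.prod_erase_mul (s := Finset.univ) (f := fun j => μ j (s j)) (a := i)
      (Finset.mem_univ i)]
  simp only [Function.update_self, measure_univ, mul_one]
  congr 1
  refine Finset.prod_congr rfl fun j hj => ?_
  rw [Function.update_of_ne (Finset.ne_of_mem_erase hj)]

/-- Law of one row of the demand table. -/
noncomputable def rowLaw (ν : Demand) : Measure (Fin 2 → unitInterval) :=
  Measure.pi fun k => (ν k : Measure unitInterval)

instance (ν : Demand) : IsProbabilityMeasure (rowLaw ν) := by
  unfold rowLaw; infer_instance

theorem integral_rowLaw_apply (ν : Demand) (k : Fin 2) {f : unitInterval → ℝ}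
    (hf : Measurable f) : ∫ x, f (x k) ∂rowLaw ν = ∫ y, f y ∂(ν k : Measure unitInterval) := by
  have h := measurePreserving_eval (fun k => (ν k : Measure unitInterval)) k
  rw [← h.map_eq, integral_map h.measurable.aemeasurable hf.aestronglyMeasurable]
  rfl

theorem integral_demandLaw_update {T : ℕ} (ν : Demand) (t : Fin T)
    {f : (Fin T → Fin 2 → unitInterval) → ℝ} (hf : Measurable f) {C : ℝ} (hC : ∀ D, |f D| ≤ C) :
    ∫ D, f D ∂demandLaw T ν =
      ∫ D, ∫ x, f (Function.update D t x) ∂rowLaw ν ∂demandLaw T ν := by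
  have h := measurePreserving_update (fun _ : Fin T => rowLaw ν) t
  change MeasurePreserving _ ((demandLaw T ν).prod (rowLaw ν)) (demandLaw T ν) at h
  conv_lhs => rw [← h.map_eq]
  rw [integral_map h.measurable.aemeasurable hf.aestronglyMeasurable, integral_prod]
  exact Integrable.of_bound (hf.comp h.measurable).aestronglyMeasurable C
    (Filter.Eventually.of_forall fun x => hC _)

/-- Since the demand at time step `t` is independent of the price set then, its mean may be
substituted for it. -/
theorem integral_price_mul_demand {T : ℕ} (p : PricePair) (ν : Demand) (π : Policy) (ω : π.Seed)
    (t : Fin T) :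
    ∫ D, p.val (chosen π ω (extend D) t) * (D t (chosen π ω (extend D) t) : ℝ) ∂demandLaw T ν =
      ∫ D, meanReward p ν (chosen π ω (extend D) t) ∂demandLaw T ν := by
  have hk : Measurable fun D : Fin T → Fin 2 → unitInterval => chosen π ω (extend D) t :=
    (measurable_chosen_extend π T t).comp measurable_prodMk_left
  have hp : Measurable p.val := Measurable.of_discrete
  rw [integral_demandLaw_update ν t (C := 1)]
  · refine integral_congr_ae (Filter.Eventually.of_forall fun D => ?_)
    have hc (x : Fin 2 → unitInterval) :
        chosen π ω (extend (Function.update D t x)) t = chosen π ω (extend D) t :=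
      chosen_congr π ω fun s hs => extend_update_of_ne D t x hs.ne
    simp only [hc, Function.update_self]
    rw [integral_const_mul, integral_rowLaw_apply ν _ measurable_subtype_coe]
    rfl
  · exact (hp.comp hk).mul
      (measurable_subtype_coe.comp (measurable_apply_comp (measurable_pi_apply t) hk))
  · intro D
    have h1 := p.mem (chosen π ω (extend D) t)
    have h2 := (D t (chosen π ω (extend D) t)).2
    rw [abs_of_nonneg (mul_nonneg h1.1 h2.1)]
    exact mul_le_one₀ h1.2 h2.1 h2.2

/-! ### The regret as an expected sum -/

theorem meanDemand_mem (ν : Demand) (k : Fin 2) : meanDemand ν k ∈ Set.Icc (0 : ℝ) 1 := by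
  refine ⟨integral_nonneg fun x => x.2.1, ?_⟩
  have := integral_mono (μ := (ν k : Measure unitInterval)) (f := fun x => (x : ℝ))
    (g := fun _ => 1) (Integrable.of_bound measurable_subtype_coe.aestronglyMeasurable 1
      (Filter.Eventually.of_forall fun x => ?_)) (integrable_const _) fun x => x.2.2
  · simpa [meanDemand] using this
  · rw [Real.norm_eq_abs, abs_of_nonneg x.2.1]
    exact x.2.2

theorem meanReward_mem (p : PricePair) (ν : Demand) (k : Fin 2) :
    meanReward p ν k ∈ Set.Icc (0 : ℝ) 1 :=
  have h := meanDemand_mem ν k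
  ⟨mul_nonneg (p.mem k).1 h.1, mul_le_one₀ (p.mem k).2 h.1 h.2⟩

/-- The loss of a run of a policy: at each time step, the gap between the mean rewards of the
better price and of the price set, plus the refund paid to the customer of that time step. -/
noncomputable def loss {T : ℕ} (M : ℕ) (p : PricePair) (ν : Demand) (π : Policy)
    (x : π.Seed × (Fin T → Fin 2 → unitInterval)) : ℝ :=
  ∑ t : Fin T, (max (meanReward p ν 0) (meanReward p ν 1) -
      meanReward p ν (chosen π x.1 (extend x.2) t) +
    (p.val (chosen π x.1 (extend x.2) t) -
      finalPrice M p (fun s => chosen π x.1 (extend x.2) s) t) *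
        (x.2 t (chosen π x.1 (extend x.2) t) : ℝ))

theorem finalPrice_le {T : ℕ} (M : ℕ) (p : PricePair) (i : Fin T → Fin 2) (t : Fin T) :
    finalPrice M p i t ≤ p.val (i t) :=
  Finset.inf'_le (fun s => p.val (i s)) (b := t) (by simp)

theorem measurable_finalPrice {T : ℕ} (M : ℕ) (p : PricePair) (π : Policy) (t : Fin T) :
    Measurable fun x : π.Seed × (Fin T → Fin 2 → unitInterval) =>
      finalPrice M p (fun s => chosen π x.1 (extend x.2) s) t := by
  have h : Measurable fun i : Fin T → Fin 2 => finalPrice M p i t := Measurable.of_discrete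
  exact h.comp (measurable_pi_iff.2 fun s => measurable_chosen_extend π T s)

theorem measurable_demand_chosen {T : ℕ} (π : Policy) (t : Fin T) :
    Measurable fun x : π.Seed × (Fin T → Fin 2 → unitInterval) =>
      (x.2 t (chosen π x.1 (extend x.2) t) : ℝ) :=
  measurable_subtype_coe.comp (measurable_apply_comp ((measurable_pi_apply t).comp measurable_snd)
    (measurable_chosen_extend π T t))

theorem measurable_loss {T : ℕ} (M : ℕ) (p : PricePair) (ν : Demand) (π : Policy) :
    Measurable (loss (T := T) M p ν π) := by
  refine Finset.measurable_sum _ fun t _ => ?_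
  have hk := measurable_chosen_extend π T t
  have hp : Measurable p.val := Measurable.of_discrete
  have hr : Measurable (meanReward p ν) := Measurable.of_discrete
  exact (measurable_const.sub (hr.comp hk)).add
    (((hp.comp hk).sub (measurable_finalPrice M p π t)).mul (measurable_demand_chosen π t))

theorem loss_mem {T : ℕ} (M : ℕ) (p : PricePair) (ν : Demand) (π : Policy)
    (x : π.Seed × (Fin T → Fin 2 → unitInterval)) :
    loss M p ν π x ∈ Set.Icc (0 : ℝ) (T * 2) := by
  have key : ∀ t : Fin T, _ ∈ Set.Icc (0 : ℝ) 2 := fun t => by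
    have hx := (x.2 t (chosen π x.1 (extend x.2) t)).2
    have h1 := finalPrice_le M p (fun s => chosen π x.1 (extend x.2) s) t
    have h2 := finalPrice_mem M p (fun s => chosen π x.1 (extend x.2) s) t
    have h3 := (p.mem (chosen π x.1 (extend x.2) t)).2
    have hm : meanReward p ν (chosen π x.1 (extend x.2) t) ≤
        max (meanReward p ν 0) (meanReward p ν 1) := by
      generalize chosen π x.1 (extend x.2) t = k
      fin_cases k
      · exact le_max_left _ _
      · exact le_max_right _ _
    have hm' : max (meanReward p ν 0) (meanReward p ν 1) ≤ 1 :=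
      max_le (meanReward_mem p ν 0).2 (meanReward_mem p ν 1).2
    have h0 := (meanReward_mem p ν (chosen π x.1 (extend x.2) t)).1
    have h4 := mul_le_one₀ (sub_le_self _ h2.1 |>.trans h3) hx.1 hx.2
    exact ⟨add_nonneg (sub_nonneg.2 hm) (mul_nonneg (sub_nonneg.2 h1) hx.1),
      (add_le_add (sub_le_self _ h0 |>.trans hm') h4).trans (by norm_num)⟩
  refine ⟨Finset.sum_nonneg fun t _ => (key t).1, ?_⟩
  refine (Finset.sum_le_card_nsmul _ _ 2 fun t _ => (key t).2).trans ?_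
  simp

theorem integrable_of_measurable_of_abs_le {α : Type*} [MeasurableSpace α] {μ : Measure α}
    [IsFiniteMeasure μ] {f : α → ℝ} (hf : Measurable f) (C : ℝ) (hC : ∀ x, |f x| ≤ C) :
    Integrable f μ :=
  Integrable.of_bound hf.aestronglyMeasurable C (Filter.Eventually.of_forall hC)

theorem integrable_loss {T : ℕ} (M : ℕ) (p : PricePair) (ν ν' : Demand) (π : Policy) :
    Integrable (loss M p ν π) (π.seedLaw.prod (demandLaw T ν')) :=
  integrable_of_measurable_of_abs_le (measurable_loss M p ν π) (T * 2) fun x => by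
    rw [abs_of_nonneg (loss_mem M p ν π x).1]
    exact (loss_mem M p ν π x).2

/-- The regret is the expected loss. -/
theorem regret_eq_integral_loss (T M : ℕ) (p : PricePair) (ν : Demand) (π : Policy) :
    regret T M p ν π = ∫ x, loss M p ν π x ∂(π.seedLaw.prod (demandLaw T ν)) := by
  set P := π.seedLaw.prod (demandLaw T ν) with hP
  have hk (t : Fin T) := measurable_chosen_extend π T t
  have hp : Measurable p.val := Measurable.of_discrete
  have hr : Measurable (meanReward p ν) := Measurable.of_discrete
  have i1 (t : Fin T) : Integrable (fun x : π.Seed × (Fin T → Fin 2 → unitInterval) =>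
      meanReward p ν (chosen π x.1 (extend x.2) t)) P :=
    integrable_of_measurable_of_abs_le (hr.comp (hk t)) 1 fun x => by
      rw [abs_of_nonneg (meanReward_mem p ν _).1]
      exact (meanReward_mem p ν _).2
  have i2 (t : Fin T) : Integrable (fun x : π.Seed × (Fin T → Fin 2 → unitInterval) =>
      p.val (chosen π x.1 (extend x.2) t) * (x.2 t (chosen π x.1 (extend x.2) t) : ℝ)) P :=
    integrable_of_measurable_of_abs_le ((hp.comp (hk t)).mul (measurable_demand_chosen π t)) 1
      fun x => by
        have hx := (x.2 t (chosen π x.1 (extend x.2) t)).2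
        have h3 := p.mem (chosen π x.1 (extend x.2) t)
        rw [abs_of_nonneg (mul_nonneg h3.1 hx.1)]
        exact mul_le_one₀ h3.2 hx.1 hx.2
  have i3 : Integrable (fun x : π.Seed × (Fin T → Fin 2 → unitInterval) =>
      revenue M p π x.1 x.2) P :=
    integrable_of_measurable_of_abs_le (Finset.measurable_sum _ fun t _ =>
      (measurable_finalPrice M p π t).mul (measurable_demand_chosen π t)) T fun x => by
        rw [abs_of_nonneg (revenue_mem M p π x.1 x.2).1]
        exact (revenue_mem M p π x.1 x.2).2
  have e (t : Fin T) : ∫ x, p.val (chosen π x.1 (extend x.2) t) *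
      (x.2 t (chosen π x.1 (extend x.2) t) : ℝ) ∂P =
      ∫ x, meanReward p ν (chosen π x.1 (extend x.2) t) ∂P := by
    rw [hP, integral_prod _ (i2 t), integral_prod _ (i1 t)]
    exact integral_congr_ae (Filter.Eventually.of_forall fun ω =>
      integral_price_mul_demand p ν π ω t)
  have hl (x : π.Seed × (Fin T → Fin 2 → unitInterval)) : loss M p ν π x =
      T * max (meanReward p ν 0) (meanReward p ν 1) -
        ∑ t : Fin T, meanReward p ν (chosen π x.1 (extend x.2) t) +
      ∑ t : Fin T, p.val (chosen π x.1 (extend x.2) t) *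
        (x.2 t (chosen π x.1 (extend x.2) t) : ℝ) - revenue M p π x.1 x.2 := by
    simp only [loss, revenue, Finset.sum_add_distrib, Finset.sum_sub_distrib, sub_mul,
      Finset.sum_const, Finset.card_univ, Fintype.card_fin, nsmul_eq_mul]
    ring
  simp only [hl]
  rw [integral_sub _ i3, integral_add, integral_sub, integral_finsetSum _ fun t _ => i1 t,
    integral_finsetSum _ fun t _ => i2 t]
  · simp only [e]
    simp [regret, expectedRevenue, hP]
  · exact integrable_const _
  · exact integrable_finsetSum _ fun t _ => i1 t
  · exact (integrable_const _).sub (integrable_finsetSum _ fun t _ => i1 t)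
  · exact integrable_finsetSum _ fun t _ => i2 t
  · exact ((integrable_const _).sub (integrable_finsetSum _ fun t _ => i1 t)).add
      (integrable_finsetSum _ fun t _ => i2 t)

/-! ### The minimax value -/

theorem optRegret_le {T M : ℕ} {b : ℝ} (π : PricePair → Policy)
    (h : ∀ p ν, regret T M p ν (π p) ≤ b) : optRegret T M ≤ b := by
  have : Nonempty PricePair :=
    ⟨⟨![0, 1], by intro k; fin_cases k <;> simp, by simp⟩⟩
  have : Nonempty Demand := ⟨fun _ => ⟨Measure.dirac 0, inferInstance⟩⟩
  refine (ciInf_le ⟨-(T : ℝ), ?_⟩ π).trans (ciSup_le fun e => h e.1 e.2)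
  rintro _ ⟨π', rfl⟩
  obtain ⟨e⟩ : Nonempty (PricePair × Demand) := inferInstance
  have hb : BddAbove (Set.range fun e : PricePair × Demand => regret T M e.1 e.2 (π' e.1)) := by
    refine ⟨T, ?_⟩
    rintro _ ⟨e, rfl⟩
    exact (abs_le.1 (abs_regret_le T M e.1 e.2 (π' e.1))).2
  exact (abs_le.1 (abs_regret_le T M e.1 e.2 (π' e.1))).1.trans (le_ciSup hb e)

/-- The policy that always sets the price of a fixed index. -/
noncomputable def constPolicy (k : Fin 2) : Policy where
  Seed := Unit
  seedLaw := Measure.dirac ()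
  choose := fun _ _ => k
  measurable_choose := fun _ => measurable_const

theorem optRegret_le_horizon (T M : ℕ) : optRegret T M ≤ T :=
  optRegret_le (fun _ => constPolicy 0) fun p ν => (abs_le.1 (abs_regret_le T M p ν _)).2

/-- Two environments with the same prices, in which no policy has small regrets, bound the minimax
regret from below. -/
theorem le_optRegret {T M : ℕ} {b : ℝ} (p : PricePair) (ν ν' : Demand)
    (h : ∀ π, 2 * b ≤ regret T M p ν π + regret T M p ν' π) : b ≤ optRegret T M := by
  have : Nonempty (PricePair → Policy) := ⟨fun _ => constPolicy 0⟩
  refine le_ciInf fun π => ?_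
  have hb : BddAbove (Set.range fun e : PricePair × Demand => regret T M e.1 e.2 (π e.1)) := by
    refine ⟨T, ?_⟩
    rintro _ ⟨e, rfl⟩
    exact (abs_le.1 (abs_regret_le T M e.1 e.2 (π e.1))).2
  have h1 := le_ciSup hb (p, ν)
  have h2 := le_ciSup hb (p, ν')
  have h3 := h (π p)
  simp only at h1 h2
  linarith

/-! ### Refunded time steps -/

/-- The time steps within the horizon `T` at which the higher price is set while the lower price
is set during the protection period, so that the customer receives a refund. -/
def refunded (T M : ℕ) (i : ℕ → Fin 2) : Finset ℕ :=
  (Finset.range T).filter fun t => i t = 1 ∧ ∃ s < T, t ≤ s ∧ s ≤ t + M ∧ i s = 0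

theorem finalPrice_eq_of_notMem_refunded {T M : ℕ} (p : PricePair) (i : ℕ → Fin 2) (t : Fin T)
    (h : (t : ℕ) ∉ refunded T M i) : finalPrice M p (fun s : Fin T => i s) t = p.val (i t) := by
  refine le_antisymm (finalPrice_le M p _ t) (Finset.le_inf' _ _ fun s hs => ?_)
  simp only [Finset.mem_filter, Finset.mem_univ, true_and] at hs
  simp only [refunded, Finset.mem_filter, Finset.mem_range, t.2, true_and, not_and,
    not_exists] at h
  rcases Fin.exists_fin_two.1 ⟨i t, rfl⟩ with ht | ht <;>
    rcases Fin.exists_fin_two.1 ⟨i s, rfl⟩ with hs' | hs'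
  · simp only [ht, hs', le_refl]
  · simp only [ht, hs', p.lt.le]
  · exact (h ht s s.2 hs.1 hs.2 hs').elim
  · simp only [ht, hs', le_refl]

theorem finalPrice_le_of_mem_refunded {T M : ℕ} (p : PricePair) (i : ℕ → Fin 2) (t : Fin T)
    (h : (t : ℕ) ∈ refunded T M i) : finalPrice M p (fun s : Fin T => i s) t ≤ p.val 0 := by
  simp only [refunded, Finset.mem_filter] at h
  obtain ⟨-, -, s, hs, h1, h2, h3⟩ := h
  have := Finset.inf'_le (fun s : Fin T => p.val (i s)) (b := ⟨s, hs⟩)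
    (s := Finset.univ.filter (fun s : Fin T => t ≤ s ∧ (s : ℕ) ≤ t + M))
    (by simp only [Finset.mem_filter, Finset.mem_univ, true_and]; exact ⟨h1, h2⟩)
  rw [h3] at this
  exact this

theorem card_filter_range_eq_sum (T : ℕ) (P : ℕ → Prop) [DecidablePred P] :
    (((Finset.range T).filter P).card : ℝ) = ∑ t : Fin T, if P t then (1 : ℝ) else 0 := by
  rw [Fin.sum_univ_eq_sum_range (fun t => if P t then (1 : ℝ) else 0) T, Finset.sum_boole]

theorem card_refunded_eq_sum (T M : ℕ) (i : ℕ → Fin 2) :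
    ((refunded T M i).card : ℝ) =
      ∑ t : Fin T, if (t : ℕ) ∈ refunded T M i then (1 : ℝ) else 0 := by
  rw [← card_filter_range_eq_sum T fun t => t ∈ refunded T M i, Finset.filter_mem_eq_inter,
    Finset.inter_eq_right.2 (show refunded T M i ⊆ _ from Finset.filter_subset _ _)]

/-- A policy that sets the higher price `n ≤ M` times before time step `h` either never returns to
the lower price from then on or pays at least `n` refunds: if one of these `n` customers gets no
refund, then all `M` customers before the next use of the lower price get one. -/
theorem forall_eq_one_or_le_card_refunded {T M n h : ℕ} (i : ℕ → Fin 2) (hT : h ≤ T) (hn : n ≤ M)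
    (hc : n ≤ ((Finset.range h).filter fun t => i t = 1).card) :
    (∀ s < T, h ≤ s → i s = 1) ∨ n ≤ (refunded T M i).card := by
  by_contra! hcon
  obtain ⟨⟨s, hsT, hs, his⟩, hr⟩ := hcon
  have his : i s = 0 := by omega
  by_cases hsub : ((Finset.range h).filter fun t => i t = 1) ⊆ refunded T M i
  · exact absurd (hc.trans (Finset.card_le_card hsub)) (by omega)
  obtain ⟨t, ht, htr⟩ := Finset.not_subset.1 hsub
  simp only [Finset.mem_filter, Finset.mem_range] at ht
  have hex : ∃ s, t < s ∧ i s = 0 := ⟨s, by omega, his⟩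
  classical
  set u := Nat.find hex with hu
  obtain ⟨hu1, hu2⟩ : t < u ∧ i u = 0 := Nat.find_spec hex
  have hus : u ≤ s := Nat.find_min' hex ⟨by omega, his⟩
  have hone : ∀ v, t ≤ v → v < u → i v = 1 := by
    intro v h1 h2
    rcases h1.eq_or_lt with rfl | h1
    · exact ht.2
    · have := Nat.find_min hex h2
      simp only [not_and] at this
      have := this h1
      omega
  have htM : t + M < u := by
    by_contra! hcon
    exact htr (by
      simp only [refunded, Finset.mem_filter, Finset.mem_range]
      exact ⟨by omega, ht.2, u, by omega, hu1.le, hcon, hu2⟩)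
  have : Finset.Ico (u - M) u ⊆ refunded T M i := by
    intro v hv
    rw [Finset.mem_Ico] at hv
    simp only [refunded, Finset.mem_filter, Finset.mem_range]
    exact ⟨by omega, hone v (by omega) hv.2, u, by omega, hv.2.le, by omega, hu2⟩
  have := Finset.card_le_card this
  rw [Nat.card_Ico] at this
  omega

/-! ### The hard environments -/

/-- The prices `1/2` and `1`. -/
noncomputable def hardPrices : PricePair where
  val := ![1 / 2, 1]
  mem := by intro k; fin_cases k <;> norm_num
  lt := by norm_num

/-- The larger demand under the higher price. -/
noncomputable def hiDemand : unitInterval := ⟨3 / 4, by norm_num, by norm_num⟩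

/-- The smaller demand under the higher price. -/
noncomputable def loDemand : unitInterval := ⟨1 / 4, by norm_num, by norm_num⟩

/-- The law giving `3/4` with probability `q` and `1/4` otherwise. -/
noncomputable def twoPoint (q : ℝ) (hq : q ∈ Set.Icc (0 : ℝ) 1) : ProbabilityMeasure unitInterval :=
  ⟨ENNReal.ofReal q • Measure.dirac hiDemand + ENNReal.ofReal (1 - q) • Measure.dirac loDemand, ⟨by
    simp [← ENNReal.ofReal_add hq.1 (sub_nonneg.2 hq.2)]⟩⟩

/-- The environment in which the demand is `1` under the lower price and follows `twoPoint q` under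
the higher price. With the prices `1/2` and `1` the two prices are equally good if `q = 1/2`. All
demands are at least `1/4`, so that a policy cannot make refunds cheap by refunding the customers of
low demand. -/
noncomputable def hardDemand (q : ℝ) (hq : q ∈ Set.Icc (0 : ℝ) 1) : Demand :=
  ![⟨Measure.dirac 1, inferInstance⟩, twoPoint q hq]

theorem integral_twoPoint {q : ℝ} (hq : q ∈ Set.Icc (0 : ℝ) 1) (f : unitInterval → ℝ) :
    ∫ y, f y ∂(twoPoint q hq : Measure unitInterval) =
      q * f hiDemand + (1 - q) * f loDemand := by
  have h : (twoPoint q hq : Measure unitInterval) = ENNReal.ofReal q • Measure.dirac hiDemand +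
    ENNReal.ofReal (1 - q) • Measure.dirac loDemand := rfl
  have hi (a : unitInterval) : Integrable f (Measure.dirac a) :=
    integrable_dirac (by simp [enorm_lt_top])
  rw [h, integral_add_measure ((hi _).smul_measure ENNReal.ofReal_ne_top)
    ((hi _).smul_measure ENNReal.ofReal_ne_top), integral_smul_measure, integral_smul_measure,
    integral_dirac, integral_dirac, ENNReal.toReal_ofReal hq.1,
    ENNReal.toReal_ofReal (sub_nonneg.2 hq.2), smul_eq_mul, smul_eq_mul]

theorem integral_hardDemand_zero {q : ℝ} (hq : q ∈ Set.Icc (0 : ℝ) 1) (f : unitInterval → ℝ) :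
    ∫ y, f y ∂(hardDemand q hq 0 : Measure unitInterval) = f 1 :=
  integral_dirac f 1

theorem integral_hardDemand_one {q : ℝ} (hq : q ∈ Set.Icc (0 : ℝ) 1) (f : unitInterval → ℝ) :
    ∫ y, f y ∂(hardDemand q hq 1 : Measure unitInterval) =
      q * f hiDemand + (1 - q) * f loDemand :=
  integral_twoPoint hq f

theorem meanReward_hard_zero {q : ℝ} (hq : q ∈ Set.Icc (0 : ℝ) 1) :
    meanReward hardPrices (hardDemand q hq) 0 = 1 / 2 := by
  rw [meanReward, meanDemand, integral_hardDemand_zero]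
  simp [hardPrices]

theorem meanReward_hard_one {q : ℝ} (hq : q ∈ Set.Icc (0 : ℝ) 1) :
    meanReward hardPrices (hardDemand q hq) 1 = 1 / 4 + q / 2 := by
  rw [meanReward, meanDemand, integral_hardDemand_one]
  simp only [hardPrices, hiDemand, loDemand, Matrix.cons_val_one, Matrix.cons_val_zero]
  ring

theorem ae_le_hardDemand {q : ℝ} (hq : q ∈ Set.Icc (0 : ℝ) 1) (k : Fin 2) :
    ∀ᵐ y : unitInterval ∂(hardDemand q hq k : Measure unitInterval), (1 / 4 : ℝ) ≤ y := by
  have hm : MeasurableSet {y : unitInterval | (1 / 4 : ℝ) ≤ y} :=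
    measurableSet_le measurable_const measurable_subtype_coe
  rcases Fin.exists_fin_two.1 ⟨k, rfl⟩ with rfl | rfl
  · change ∀ᵐ y : unitInterval ∂(Measure.dirac (1 : unitInterval)), (1 / 4 : ℝ) ≤ y
    rw [ae_dirac_iff hm]
    norm_num
  · change ∀ᵐ y : unitInterval ∂(ENNReal.ofReal q • Measure.dirac hiDemand +
      ENNReal.ofReal (1 - q) • Measure.dirac loDemand), (1 / 4 : ℝ) ≤ y
    rw [ae_add_measure_iff]
    refine ⟨Measure.ae_smul_measure ?_ _, Measure.ae_smul_measure ?_ _⟩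
    · rw [ae_dirac_iff hm]; norm_num [hiDemand]
    · rw [ae_dirac_iff hm]; norm_num [loDemand]

theorem ae_le_demandLaw_hard {q : ℝ} (hq : q ∈ Set.Icc (0 : ℝ) 1) (T : ℕ) :
    ∀ᵐ D : Fin T → Fin 2 → unitInterval ∂demandLaw T (hardDemand q hq),
      ∀ t k, (1 / 4 : ℝ) ≤ D t k := by
  rw [ae_all_iff]
  intro t
  rw [ae_all_iff]
  intro k
  have h1 := measurePreserving_eval (fun _ : Fin T => rowLaw (hardDemand q hq)) t
  have h2 := measurePreserving_eval (fun k => (hardDemand q hq k : Measure unitInterval)) k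
  exact h1.quasiMeasurePreserving.ae (h2.quasiMeasurePreserving.ae (ae_le_hardDemand hq k))

/-! ### Indistinguishability -/

/-- Number of times the higher price was set in a history. -/
def highCount {t : ℕ} (h : Fin t → Fin 2 × unitInterval) : ℕ := ∑ s, ((h s).1 : ℕ)

theorem highCount_snoc {t : ℕ} (h : Fin t → Fin 2 × unitInterval) (y : Fin 2 × unitInterval) :
    highCount (Fin.snoc (α := fun _ => Fin 2 × unitInterval) h y) = highCount h + y.1 := by
  simp [highCount, Fin.sum_univ_castSucc]

theorem measurable_highCount {t : ℕ} :
    Measurable (highCount : (Fin t → Fin 2 × unitInterval) → ℕ) := by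
  have h : Measurable (fun k : Fin 2 => (k : ℕ)) := Measurable.of_discrete
  exact Finset.measurable_sum _ fun s _ =>
    h.comp (measurable_fst.comp (measurable_pi_apply s))

theorem highCount_history (π : Policy) (ω : π.Seed) (D : ℕ → Fin 2 → unitInterval) (h : ℕ) :
    highCount (history π ω D h) =
      ((Finset.range h).filter fun t => chosen π ω D t = 1).card := by
  simp only [highCount, history_apply]
  rw [Fin.sum_univ_eq_sum_range (fun t => (chosen π ω D t : ℕ)) h, Finset.card_filter]
  refine Finset.sum_congr rfl fun t _ => ?_
  generalize chosen π ω D t = k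
  fin_cases k <;> simp

/-- Conditional expectation of a function of the history after time step `t`, given the history
before it, in the environment `hardDemand q`. -/
noncomputable def stepBack (π : Policy) (ω : π.Seed) (q : ℝ) {t : ℕ}
    (F : (Fin (t + 1) → Fin 2 × unitInterval) → ℝ) (h : Fin t → Fin 2 × unitInterval) : ℝ :=
  if π.choose t (ω, h) = 0 then F (Fin.snoc (α := fun _ => Fin 2 × unitInterval) h (0, 1))
  else q * F (Fin.snoc (α := fun _ => Fin 2 × unitInterval) h (1, hiDemand)) +
    (1 - q) * F (Fin.snoc (α := fun _ => Fin 2 × unitInterval) h (1, loDemand))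

theorem measurable_stepBack (π : Policy) (ω : π.Seed) (q : ℝ) {t : ℕ}
    {F : (Fin (t + 1) → Fin 2 × unitInterval) → ℝ} (hF : Measurable F) :
    Measurable (stepBack π ω q F) := by
  have h (y : Fin 2 × unitInterval) := hF.comp (measurable_snoc
    (measurable_id (α := Fin t → Fin 2 × unitInterval)) (measurable_const (a := y)))
  refine Measurable.ite ?_ (h _) (((h _).const_mul _).add ((h _).const_mul _))
  exact ((π.measurable_choose t).comp measurable_prodMk_left) (measurableSet_singleton 0)

theorem stepBack_mem (π : Policy) (ω : π.Seed) {q : ℝ} (hq : q ∈ Set.Icc (0 : ℝ) 1) {t : ℕ}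
    {F : (Fin (t + 1) → Fin 2 × unitInterval) → ℝ} (hF : ∀ h, F h ∈ Set.Icc (0 : ℝ) 1)
    (h : Fin t → Fin 2 × unitInterval) : stepBack π ω q F h ∈ Set.Icc (0 : ℝ) 1 := by
  unfold stepBack
  split_ifs
  · exact hF _
  · exact (convex_Icc (0 : ℝ) 1) (hF _) (hF _) hq.1 (sub_nonneg.2 hq.2) (by ring)

theorem integral_history_succ {T t : ℕ} (ht : t < T) (π : Policy) (ω : π.Seed) {q : ℝ}
    (hq : q ∈ Set.Icc (0 : ℝ) 1) {F : (Fin (t + 1) → Fin 2 × unitInterval) → ℝ}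
    (hm : Measurable F) (hF : ∀ h, F h ∈ Set.Icc (0 : ℝ) 1) :
    ∫ D, F (history π ω (extend D) (t + 1)) ∂demandLaw T (hardDemand q hq) =
      ∫ D, stepBack π ω q F (history π ω (extend D) t) ∂demandLaw T (hardDemand q hq) := by
  rw [integral_demandLaw_update _ ⟨t, ht⟩ (C := 1)]
  · refine integral_congr_ae (Filter.Eventually.of_forall fun D => ?_)
    have hh (x : Fin 2 → unitInterval) :
        history π ω (extend (Function.update D ⟨t, ht⟩ x)) t = history π ω (extend D) t :=
      history_congr π ω fun s hs => extend_update_of_ne D _ x hs.ne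
    have he (x : Fin 2 → unitInterval) : extend (Function.update D ⟨t, ht⟩ x) t = x := by
      have := extend_apply (Function.update D ⟨t, ht⟩ x) ⟨t, ht⟩
      simpa using this
    simp only [history_succ, chosen, hh, he, stepBack]
    have hs (k : Fin 2) : Measurable fun y : unitInterval =>
        F (Fin.snoc (α := fun _ => Fin 2 × unitInterval) (history π ω (extend D) t) (k, y)) :=
      hm.comp (measurable_snoc measurable_const measurable_prodMk_left)
    rcases Fin.exists_fin_two.1 ⟨π.choose t (ω, history π ω (extend D) t), rfl⟩ with hk | hk <;>
      rw [hk, integral_rowLaw_apply _ _ (hs _)]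
    · rw [integral_hardDemand_zero]; simp
    · rw [integral_hardDemand_one]; simp
  · exact hm.comp ((measurable_history_extend π T (t + 1)).comp measurable_prodMk_left)
  · intro D
    rw [abs_of_nonneg (hF _).1]
    exact (hF _).2

/-- The Cauchy-Schwarz step behind the multiplicativity of the Hellinger affinity. -/
theorem sqrt_mul_le_sqrt_convex {q a b : ℝ} (hq : q ∈ Set.Icc (0 : ℝ) 1) (ha : 0 ≤ a)
    (hb : 0 ≤ b) : √(q * (1 - q)) * (√a + √b) ≤ √(q * a + (1 - q) * b) := by
  have h1 : 0 ≤ 1 - q := sub_nonneg.2 hq.2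
  refine Real.le_sqrt_of_sq_le ?_
  rw [mul_pow, Real.sq_sqrt (mul_nonneg hq.1 h1)]
  nlinarith [sq_nonneg (q * √a - (1 - q) * √b), Real.sq_sqrt ha, Real.sq_sqrt hb]

/-- Change of measure between the environments `hardDemand q` and `hardDemand (1 - q)` for test
functions `F` and `G` of the history. Each use of the higher price costs a factor
`2 √(q (1 - q))`, the Hellinger affinity of the two laws, and only the first `n` uses count, as `F`
is `1` afterwards. -/
theorem pow_le_sqrt_add_sqrt {T t n : ℕ} (ht : t ≤ T) (π : Policy) (ω : π.Seed) {q : ℝ}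
    (hq : q ∈ Set.Icc (0 : ℝ) 1) (hq' : 1 - q ∈ Set.Icc (0 : ℝ) 1)
    {F G : (Fin t → Fin 2 × unitInterval) → ℝ} (hmF : Measurable F) (hmG : Measurable G)
    (hF : ∀ h, F h ∈ Set.Icc (0 : ℝ) 1) (hG : ∀ h, G h ∈ Set.Icc (0 : ℝ) 1)
    (hF1 : ∀ h, n ≤ highCount h → F h = 1)
    (hFG : ∀ h, (2 * √(q * (1 - q))) ^ (n - highCount h) ≤ √(F h) + √(G h)) :
    (2 * √(q * (1 - q))) ^ n ≤
      √(∫ D, F (history π ω (extend D) t) ∂demandLaw T (hardDemand q hq)) +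
      √(∫ D, G (history π ω (extend D) t) ∂demandLaw T (hardDemand (1 - q) hq')) := by
  induction t with
  | zero =>
    have := hFG Fin.elim0
    simpa [history, highCount] using this
  | succ t ih =>
    rw [integral_history_succ ht π ω hq hmF hF, integral_history_succ ht π ω hq' hmG hG]
    refine ih (by omega) (measurable_stepBack π ω _ hmF) (measurable_stepBack π ω _ hmG)
      (stepBack_mem π ω hq hF) (stepBack_mem π ω hq' hG) (fun h hh => ?_) fun h => ?_
    · unfold stepBack
      rw [hF1 _ (by rw [highCount_snoc]; omega), hF1 _ (by rw [highCount_snoc]; omega),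
        hF1 _ (by rw [highCount_snoc]; omega)]
      simp
    · by_cases hk : π.choose t (ω, h) = 0
      · have := hFG (Fin.snoc (α := fun _ => Fin 2 × unitInterval) h (0, 1))
        rw [highCount_snoc] at this
        simpa [stepBack, hk] using this
      by_cases hn : n ≤ highCount h
      · have h1 : stepBack π ω q F h = 1 := by
          unfold stepBack
          rw [hF1 _ (by rw [highCount_snoc]; omega), hF1 _ (by rw [highCount_snoc]; omega),
            hF1 _ (by rw [highCount_snoc]; omega)]
          simp
        rw [h1, Nat.sub_eq_zero_of_le hn]
        simp
      · have a1 := hFG (Fin.snoc (α := fun _ => Fin 2 × unitInterval) h (1, hiDemand))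
        have a2 := hFG (Fin.snoc (α := fun _ => Fin 2 × unitInterval) h (1, loDemand))
        rw [highCount_snoc] at a1 a2
        have e : n - highCount h = n - (highCount h + ((1 : Fin 2) : ℕ)) + 1 := by
          simp only [Fin.val_one]; omega
        simp only [stepBack, if_neg hk]
        have b1 := sqrt_mul_le_sqrt_convex hq
          (hF (Fin.snoc (α := fun _ => Fin 2 × unitInterval) h (1, hiDemand))).1
          (hF (Fin.snoc (α := fun _ => Fin 2 × unitInterval) h (1, loDemand))).1
        have b2 := sqrt_mul_le_sqrt_convex hq'
          (hG (Fin.snoc (α := fun _ => Fin 2 × unitInterval) h (1, hiDemand))).1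
          (hG (Fin.snoc (α := fun _ => Fin 2 × unitInterval) h (1, loDemand))).1
        rw [show (1 - q) * (1 - (1 - q)) = q * (1 - q) by ring] at b2
        rw [e, pow_succ]
        have hr := Real.sqrt_nonneg (q * (1 - q))
        have := mul_le_mul_of_nonneg_left (add_le_add a1 a2) hr
        linarith

/-- Two environments that differ only in the law under the higher price, and little enough, cannot
be told apart by `n` uses of the higher price. -/
theorem one_eighth_le_prob_add_prob {T h n : ℕ} (hT : h ≤ T) (π : Policy) (ω : π.Seed) {q : ℝ}
    (hq : q ∈ Set.Icc (0 : ℝ) 1) (hq' : 1 - q ∈ Set.Icc (0 : ℝ) 1)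
    (hn : 1 / 2 ≤ (2 * √(q * (1 - q))) ^ n) :
    1 / 8 ≤
      (∫ D, (if n ≤ highCount (history π ω (extend D) h) then (1 : ℝ) else 0)
        ∂demandLaw T (hardDemand q hq)) +
      ∫ D, (if n ≤ highCount (history π ω (extend D) h) then (0 : ℝ) else 1)
        ∂demandLaw T (hardDemand (1 - q) hq') := by
  have hr : 2 * √(q * (1 - q)) ≤ 1 := by
    have : √(q * (1 - q)) ≤ 1 / 2 := Real.sqrt_le_iff.2 ⟨by norm_num, by
      nlinarith [sq_nonneg (q - 1 / 2)]⟩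
    linarith
  have hr0 : 0 ≤ 2 * √(q * (1 - q)) := by positivity
  have hs : MeasurableSet {x : Fin h → Fin 2 × unitInterval | n ≤ highCount x} :=
    measurableSet_le measurable_const measurable_highCount
  have key := pow_le_sqrt_add_sqrt (n := n) hT π ω hq hq'
    (F := fun x => if n ≤ highCount x then 1 else 0)
    (G := fun x => if n ≤ highCount x then 0 else 1)
    (Measurable.ite hs measurable_const measurable_const)
    (Measurable.ite hs measurable_const measurable_const)
    (fun x => by split_ifs <;> simp) (fun x => by split_ifs <;> simp)
    (fun x hx => by simp [hx]) (fun x => by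
      split_ifs <;> simpa using pow_le_one₀ hr0 hr)
  set a := ∫ D, (if n ≤ highCount (history π ω (extend D) h) then (1 : ℝ) else 0)
        ∂demandLaw T (hardDemand q hq) with ha
  set b := ∫ D, (if n ≤ highCount (history π ω (extend D) h) then (0 : ℝ) else 1)
        ∂demandLaw T (hardDemand (1 - q) hq') with hb
  have ha0 : 0 ≤ a := integral_nonneg fun D => by dsimp only; split_ifs <;> simp
  have hb0 : 0 ≤ b := integral_nonneg fun D => by dsimp only; split_ifs <;> simp
  have h2 := hn.trans key
  nlinarith [Real.sq_sqrt ha0, Real.sq_sqrt hb0, sq_nonneg (√a - √b), Real.sqrt_nonneg a,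
    Real.sqrt_nonneg b]

/-- The regrets in the two hard environments cannot both be small. -/
theorem le_regret_add_regret {T M h n : ℕ} (hT : h ≤ T) (π : Policy) {q c : ℝ} (hc : 0 ≤ c)
    (hq : q ∈ Set.Icc (0 : ℝ) 1) (hq' : 1 - q ∈ Set.Icc (0 : ℝ) 1)
    (hn : 1 / 2 ≤ (2 * √(q * (1 - q))) ^ n)
    (h1 : ∀ x : π.Seed × (Fin T → Fin 2 → unitInterval), (∀ t k, (1 / 4 : ℝ) ≤ x.2 t k) →
      n ≤ highCount (history π x.1 (extend x.2) h) →
        c ≤ loss M hardPrices (hardDemand q hq) π x)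
    (h2 : ∀ x : π.Seed × (Fin T → Fin 2 → unitInterval), (∀ t k, (1 / 4 : ℝ) ≤ x.2 t k) →
      highCount (history π x.1 (extend x.2) h) < n →
        c ≤ loss M hardPrices (hardDemand (1 - q) hq') π x) :
    c / 8 ≤ regret T M hardPrices (hardDemand q hq) π +
      regret T M hardPrices (hardDemand (1 - q) hq') π := by
  have hs : MeasurableSet {x : π.Seed × (Fin T → Fin 2 → unitInterval) |
      n ≤ highCount (history π x.1 (extend x.2) h)} :=
    measurableSet_le measurable_const
      (measurable_highCount.comp (measurable_history_extend π T h))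
  have hmf : Measurable fun x : π.Seed × (Fin T → Fin 2 → unitInterval) =>
      if n ≤ highCount (history π x.1 (extend x.2) h) then (1 : ℝ) else 0 :=
    Measurable.ite hs measurable_const measurable_const
  have hmg : Measurable fun x : π.Seed × (Fin T → Fin 2 → unitInterval) =>
      if n ≤ highCount (history π x.1 (extend x.2) h) then (0 : ℝ) else 1 :=
    Measurable.ite hs measurable_const measurable_const
  have hif (ν : Demand) : Integrable _ (π.seedLaw.prod (demandLaw T ν)) :=
    integrable_of_measurable_of_abs_le hmf 1 fun x => by split_ifs <;> simp
  have hig (ν : Demand) : Integrable _ (π.seedLaw.prod (demandLaw T ν)) :=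
    integrable_of_measurable_of_abs_le hmg 1 fun x => by split_ifs <;> simp
  have hae {q : ℝ} (hq : q ∈ Set.Icc (0 : ℝ) 1) :
      ∀ᵐ x ∂(π.seedLaw.prod (demandLaw T (hardDemand q hq))), ∀ t k, (1 / 4 : ℝ) ≤ x.2 t k :=
    Measure.quasiMeasurePreserving_snd.ae (ae_le_demandLaw_hard hq T)
  rw [regret_eq_integral_loss, regret_eq_integral_loss]
  have e1 := integral_mono_ae ((hif (hardDemand q hq)).const_mul c)
    (integrable_loss M hardPrices (hardDemand q hq) (hardDemand q hq) π) (by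
      filter_upwards [hae hq] with x hx
      split_ifs with hcase
      · simpa using h1 x hx hcase
      · simpa using (loss_mem M _ _ π x).1)
  have e2 := integral_mono_ae ((hig (hardDemand (1 - q) hq')).const_mul c)
    (integrable_loss M hardPrices (hardDemand (1 - q) hq') (hardDemand (1 - q) hq') π) (by
      filter_upwards [hae hq'] with x hx
      split_ifs with hcase
      · simpa using (loss_mem M _ _ π x).1
      · simpa using h2 x hx (not_le.1 hcase))
  refine le_trans ?_ (add_le_add e1 e2)
  rw [integral_const_mul, integral_const_mul, integral_prod _ (hif _), integral_prod _ (hig _),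
    ← mul_add, ← integral_add (hif _).integral_prod_left (hig _).integral_prod_left]
  have := integral_mono (μ := π.seedLaw) (integrable_const (1 / 8 : ℝ))
    ((hif (hardDemand q hq)).integral_prod_left.add
      (hig (hardDemand (1 - q) hq')).integral_prod_left)
    fun ω => one_eighth_le_prob_add_prob hT π ω hq hq' hn
  rw [integral_const] at this
  simp only [probReal_univ, one_smul, Pi.add_apply] at this
  have := mul_le_mul_of_nonneg_left this hc
  linarith

/-! ### The lower bound -/

/-- A lower bound for the loss when the lower price is better. A refund costs at least `1 / 8`, as
the price difference is `1 / 2` and the demand at least `1 / 4`. -/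
theorem le_loss_of_le_half {T M : ℕ} (π : Policy) {q : ℝ} (hq : q ∈ Set.Icc (0 : ℝ) 1)
    (hq2 : q ≤ 1 / 2) (x : π.Seed × (Fin T → Fin 2 → unitInterval))
    (hx : ∀ t k, (1 / 4 : ℝ) ≤ x.2 t k) :
    (1 / 4 - q / 2) * ((Finset.range T).filter fun t => chosen π x.1 (extend x.2) t = 1).card +
      1 / 8 * (refunded T M fun t => chosen π x.1 (extend x.2) t).card ≤
      loss M hardPrices (hardDemand q hq) π x := by
  rw [card_filter_range_eq_sum, card_refunded_eq_sum, Finset.mul_sum, Finset.mul_sum,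
    ← Finset.sum_add_distrib, loss]
  refine Finset.sum_le_sum fun t _ => ?_
  have hm : max (meanReward hardPrices (hardDemand q hq) 0)
      (meanReward hardPrices (hardDemand q hq) 1) = 1 / 2 := by
    rw [meanReward_hard_zero, meanReward_hard_one]
    exact max_eq_left (by linarith)
  rw [hm]
  refine add_le_add ?_ ?_
  · rcases Fin.exists_fin_two.1 ⟨chosen π x.1 (extend x.2) t, rfl⟩ with hk | hk <;> rw [hk]
    · rw [meanReward_hard_zero]; simp
    · rw [meanReward_hard_one, if_pos rfl]; linarith
  · have h1 := hx t (chosen π x.1 (extend x.2) t)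
    split_ifs with hr
    · have h2 := finalPrice_le_of_mem_refunded hardPrices _ t hr
      simp only [refunded, Finset.mem_filter] at hr
      have h3 : hardPrices.val (chosen π x.1 (extend x.2) t) = 1 := by
        rw [hr.2.1]; simp [hardPrices]
      have h4 : hardPrices.val 0 = 1 / 2 := by simp [hardPrices]
      rw [h3]
      rw [h4] at h2
      nlinarith
    · rw [mul_zero]
      exact mul_nonneg (sub_nonneg.2 (finalPrice_le M hardPrices _ t)) (by linarith)

/-- A lower bound for the loss when the higher price is better. -/
theorem le_loss_of_half_le {T M : ℕ} (π : Policy) {q : ℝ} (hq : q ∈ Set.Icc (0 : ℝ) 1)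
    (hq2 : 1 / 2 ≤ q) (x : π.Seed × (Fin T → Fin 2 → unitInterval)) :
    (q / 2 - 1 / 4) *
      (T - ((Finset.range T).filter fun t => chosen π x.1 (extend x.2) t = 1).card) ≤
      loss M hardPrices (hardDemand q hq) π x := by
  have hT : (T : ℝ) = ∑ t : Fin T, (1 : ℝ) := by simp
  rw [card_filter_range_eq_sum, hT, ← Finset.sum_sub_distrib, Finset.mul_sum, loss]
  refine Finset.sum_le_sum fun t _ => ?_
  have hm : max (meanReward hardPrices (hardDemand q hq) 0)
      (meanReward hardPrices (hardDemand q hq) 1) = 1 / 4 + q / 2 := by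
    rw [meanReward_hard_zero, meanReward_hard_one]
    exact max_eq_right (by linarith)
  rw [hm]
  refine le_add_of_le_of_nonneg ?_ (mul_nonneg (sub_nonneg.2 (finalPrice_le M hardPrices _ t))
    (x.2 t _).2.1)
  rcases Fin.exists_fin_two.1 ⟨chosen π x.1 (extend x.2) t, rfl⟩ with hk | hk <;> rw [hk]
  · rw [meanReward_hard_zero]; simp; linarith
  · rw [meanReward_hard_one, if_pos rfl]; linarith

/-- With a gap of `1 / (6 √n)` between the mean rewards, the two hard environments look the same
until the higher price has been used `n` times, so that every policy suffers in one of them: if it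
uses the higher price `n` times before time step `h`, when the lower price is better, and otherwise
when the higher price is better. -/
theorem le_optRegret_of_path {T M h n : ℕ} (hT : h ≤ T) (hn : 1 ≤ n) {c : ℝ} (hc : 0 ≤ c)
    (h1 : ∀ i : ℕ → Fin 2, n ≤ ((Finset.range h).filter fun t => i t = 1).card →
      c ≤ 1 / (6 * √n) * ((Finset.range T).filter fun t => i t = 1).card +
        1 / 8 * (refunded T M i).card)
    (h2 : c ≤ 1 / (6 * √n) * ((h : ℝ) - n)) : c / 16 ≤ optRegret T M := by
  have hn1 : (1 : ℝ) ≤ n := by exact_mod_cast hn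
  have hs1 : 1 ≤ √(n : ℝ) := Real.one_le_sqrt.2 hn1
  have hs2 : √(n : ℝ) ^ 2 = n := Real.sq_sqrt (by linarith)
  set β : ℝ := 1 / (3 * √n) with hβ
  have hβ0 : 0 < β := by positivity
  have hβ1 : β ≤ 1 / 3 := by
    rw [hβ]
    exact one_div_le_one_div_of_le (by norm_num) (by linarith)
  have hβn : n * β ^ 2 = 1 / 9 := by
    rw [hβ, div_pow, mul_pow, hs2]
    field_simp
    norm_num
  have hβ' : 1 / (6 * √(n : ℝ)) = β / 2 := by rw [hβ]; field_simp; norm_num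
  rw [hβ'] at h1 h2
  have hq : 1 / 2 - β ∈ Set.Icc (0 : ℝ) 1 := ⟨by linarith, by linarith⟩
  have hq' : 1 - (1 / 2 - β) ∈ Set.Icc (0 : ℝ) 1 := ⟨by linarith, by linarith⟩
  refine le_optRegret hardPrices (hardDemand _ hq) (hardDemand _ hq') fun π => ?_
  have haff : 1 / 2 ≤ (2 * √((1 / 2 - β) * (1 - (1 / 2 - β)))) ^ n := by
    have e : (1 / 2 - β) * (1 - (1 / 2 - β)) = 1 / 4 - β ^ 2 := by ring
    rw [e]
    have h0 : 0 ≤ 1 / 4 - β ^ 2 := by nlinarith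
    have h3 := Real.sq_sqrt h0
    have h4 := Real.sqrt_nonneg (1 / 4 - β ^ 2)
    have h5 : 1 + -(4 * β ^ 2) ≤ 2 * √(1 / 4 - β ^ 2) := by
      nlinarith [Real.sqrt_le_sqrt (show 1 / 4 - β ^ 2 ≤ (1 / 2) ^ 2 by nlinarith),
        Real.sqrt_sq (show (0 : ℝ) ≤ 1 / 2 by norm_num)]
    have h6 : (0 : ℝ) ≤ 1 + -(4 * β ^ 2) := by nlinarith
    have h7 := one_add_mul_le_pow (show (-2 : ℝ) ≤ -(4 * β ^ 2) by nlinarith) n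
    have h8 := pow_le_pow_left₀ h6 h5 n
    linarith
  have := le_regret_add_regret (M := M) hT π hc hq hq' haff (fun x hx hcount => ?_)
    fun x hx hcount => ?_
  · linarith
  · rw [highCount_history] at hcount
    refine (h1 _ hcount).trans (le_trans (le_of_eq ?_) (le_loss_of_le_half π hq (by linarith) x hx))
    ring_nf
  · rw [highCount_history] at hcount
    refine h2.trans (le_trans ?_ (le_loss_of_half_le π hq' (by linarith) x))
    have hsub : ((Finset.range T).filter fun t => chosen π x.1 (extend x.2) t = 1) ⊆
        ((Finset.range h).filter fun t => chosen π x.1 (extend x.2) t = 1) ∪ Finset.Ico h T := by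
      intro t
      simp only [Finset.mem_filter, Finset.mem_union, Finset.mem_range, Finset.mem_Ico]
      rintro ⟨h3, h4⟩
      by_cases h5 : t < h
      · exact Or.inl ⟨h5, h4⟩
      · exact Or.inr ⟨not_lt.1 h5, h3⟩
    have hcard := (Finset.card_le_card hsub).trans (Finset.card_union_le _ _)
    rw [Nat.card_Ico] at hcard
    have hle : ((Finset.range T).filter fun t => chosen π x.1 (extend x.2) t = 1).card + h ≤
        n + T := by omega
    have hle' : (((Finset.range T).filter fun t => chosen π x.1 (extend x.2) t = 1).card : ℝ) + h ≤
        n + T := by exact_mod_cast hle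
    rw [show (1 - (1 / 2 - β)) / 2 - 1 / 4 = β / 2 by ring]
    exact mul_le_mul_of_nonneg_left (by linarith) (by linarith)

/-- Here `h = T` and `n = T / 2`: the gap between the mean rewards alone gives this bound, without
refunds. -/
theorem sqrt_le_optRegret {T M : ℕ} (hT : 3 ≤ T) : √(T : ℝ) / 192 ≤ optRegret T M := by
  have h1 : 1 ≤ T / 2 := by omega
  have hn1 : (1 : ℝ) ≤ (T / 2 : ℕ) := by exact_mod_cast h1
  have hs : 0 < √((T / 2 : ℕ) : ℝ) := Real.sqrt_pos.2 (by linarith)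
  have hs2 : √((T / 2 : ℕ) : ℝ) ^ 2 = (T / 2 : ℕ) := Real.sq_sqrt (by linarith)
  have key := le_optRegret_of_path (T := T) (M := M) (h := T) (n := T / 2) le_rfl h1
    (c := 1 / (6 * √((T / 2 : ℕ) : ℝ)) * (T / 2 : ℕ)) (by positivity) (fun i hi => ?_) ?_
  · refine le_trans ?_ key
    have e : 1 / (6 * √((T / 2 : ℕ) : ℝ)) * (T / 2 : ℕ) / 16 = √((T / 2 : ℕ) : ℝ) / 96 := by
      nth_rewrite 2 [← hs2]
      field_simp
      norm_num
    rw [e]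
    have h2 : √(T : ℝ) ≤ 2 * √((T / 2 : ℕ) : ℝ) := by
      refine Real.sqrt_le_iff.2 ⟨by positivity, ?_⟩
      rw [mul_pow, hs2]
      have : T ≤ 4 * (T / 2) := by omega
      have : (T : ℝ) ≤ 4 * (T / 2 : ℕ) := by exact_mod_cast this
      linarith
    linarith
  · have hi' : ((T / 2 : ℕ) : ℝ) ≤ ((Finset.range T).filter fun t => i t = 1).card := by
      exact_mod_cast hi
    exact le_add_of_le_of_nonneg (mul_le_mul_of_nonneg_left hi' (by positivity)) (by positivity)
  · refine mul_le_mul_of_nonneg_left ?_ (by positivity)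
    have : T / 2 + T / 2 ≤ T := by omega
    have : ((T / 2 : ℕ) : ℝ) + (T / 2 : ℕ) ≤ T := by exact_mod_cast this
    linarith

/-- Here `h = T / 2`, and `n * √n ≤ T` says that using the worse price in half of the time steps,
with a gap of order `1 / √n`, costs at least of order `n`. -/
theorem le_optRegret_of_mul_sqrt_le {T M n : ℕ} (hn : 1 ≤ n) (hM : n ≤ M)
    (h8 : 8 * n ≤ T) (hnT : n * √(n : ℝ) ≤ T) : (n : ℝ) / 576 ≤ optRegret T M := by
  have hn1 : (1 : ℝ) ≤ n := by exact_mod_cast hn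
  have hs : 0 < √(n : ℝ) := Real.sqrt_pos.2 (by linarith)
  have h8' : 8 * (n : ℝ) ≤ T := by exact_mod_cast h8
  have hTh : (T : ℝ) ≤ 3 * (T / 2 : ℕ) := by
    have : T ≤ 3 * (T / 2) := by omega
    exact_mod_cast this
  have hTh' : 2 * ((T / 2 : ℕ) : ℝ) ≤ T := by
    have : 2 * (T / 2) ≤ T := by omega
    exact_mod_cast this
  have hgap {y : ℝ} (hy : (T : ℝ) ≤ 6 * y) : (n : ℝ) / 36 ≤ 1 / (6 * √(n : ℝ)) * y := by
    rw [div_mul_eq_mul_div, one_mul, div_le_div_iff₀ (by norm_num) (by positivity)]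
    linarith
  have key := le_optRegret_of_path (T := T) (M := M) (h := T / 2) (n := n) (by omega) hn
    (c := n / 36) (by positivity) (fun i hi => ?_) (hgap (by linarith))
  · linarith
  · rcases forall_eq_one_or_le_card_refunded i (by omega : T / 2 ≤ T) hM hi with h | h
    · refine le_add_of_le_of_nonneg (hgap ?_) (by positivity)
      have hsub : Finset.Ico (T / 2) T ⊆ (Finset.range T).filter fun t => i t = 1 := by
        intro t ht
        rw [Finset.mem_Ico] at ht
        exact Finset.mem_filter.2 ⟨Finset.mem_range.2 ht.2, h t ht.2 ht.1⟩
      have hcard := Finset.card_le_card hsub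
      rw [Nat.card_Ico] at hcard
      have : T ≤ 6 * ((Finset.range T).filter fun t => i t = 1).card := by omega
      exact_mod_cast this
    · have h' : (n : ℝ) ≤ (refunded T M i).card := by exact_mod_cast h
      refine le_add_of_nonneg_of_le (by positivity) (by linarith)

theorem min_le_optRegret {T M : ℕ} (hT : 3 ≤ T) :
    min (M : ℝ) ((T : ℝ) ^ (2 / 3 : ℝ)) / 9216 ≤ optRegret T M := by
  set m := min (M : ℝ) ((T : ℝ) ^ (2 / 3 : ℝ)) with hm
  have hT1 : (1 : ℝ) ≤ T := by
    have : 1 ≤ T := by omega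
    exact_mod_cast this
  have hmM : m ≤ M := min_le_left _ _
  have hmT : m ≤ (T : ℝ) ^ (2 / 3 : ℝ) := min_le_right _ _
  have hm0 : 0 ≤ m := le_min (by positivity) (by positivity)
  -- For `m < 8`, where `⌊m / 8⌋₊` vanishes, the bound of order `√T` suffices.
  rcases lt_or_ge m 8 with h8 | h8
  · have h1 := sqrt_le_optRegret (M := M) hT
    have h2 : 1 ≤ √(T : ℝ) := Real.one_le_sqrt.2 hT1
    linarith
  have hn1 : 1 ≤ ⌊m / 8⌋₊ := Nat.le_floor (by norm_num; linarith)
  have hle : (⌊m / 8⌋₊ : ℝ) ≤ m / 8 := Nat.floor_le (by positivity)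
  have hge : m / 8 < ⌊m / 8⌋₊ + 1 := Nat.lt_floor_add_one _
  have hn1' : (1 : ℝ) ≤ ⌊m / 8⌋₊ := by exact_mod_cast hn1
  have key := le_optRegret_of_mul_sqrt_le (T := T) (M := M) hn1 (by
      have : (⌊m / 8⌋₊ : ℝ) ≤ M := by linarith
      exact_mod_cast this) (by
      have : (T : ℝ) ^ (2 / 3 : ℝ) ≤ (T : ℝ) ^ (1 : ℝ) :=
        Real.rpow_le_rpow_of_exponent_le hT1 (by norm_num)
      rw [Real.rpow_one] at this
      have : 8 * (⌊m / 8⌋₊ : ℝ) ≤ T := by linarith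
      exact_mod_cast this) (by
      have hle' : (⌊m / 8⌋₊ : ℝ) ≤ (T : ℝ) ^ (2 / 3 : ℝ) := by linarith
      have hs : √(⌊m / 8⌋₊ : ℝ) ≤ (T : ℝ) ^ (1 / 3 : ℝ) := by
        refine (Real.sqrt_le_sqrt hle').trans (le_of_eq ?_)
        rw [Real.sqrt_eq_rpow, ← Real.rpow_mul (by linarith)]
        norm_num
      refine (mul_le_mul hle' hs (Real.sqrt_nonneg _) (by positivity)).trans (le_of_eq ?_)
      rw [← Real.rpow_add (by linarith)]
      norm_num)
  linarith

/-! ### Batched elimination -/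

/-- A schedule of exploration phases. In phase `k < numPhases` the lower price is set `size k` times
and then the higher price `size k` times, and afterwards the policy commits to a price if the
average rewards of the two prices within the phase differ by more than `tol k`. -/
structure Schedule where
  numPhases : ℕ
  size : ℕ → ℕ
  tol : ℕ → ℝ

namespace Schedule

variable (S : Schedule)

/-- First time step of a phase. -/
def start (k : ℕ) : ℕ := ∑ j ∈ Finset.range k, 2 * S.size j

/-- The phase of a time step, where all time steps after the last phase make up the phase
`numPhases`. -/
def phase (t : ℕ) : ℕ := Nat.findGreatest (fun k => S.start k ≤ t) S.numPhases

/-- The price that is explored at a time step. -/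
def explored (t : ℕ) : Fin 2 := if S.start (S.phase t) + S.size (S.phase t) ≤ t then 1 else 0

theorem start_succ (k : ℕ) : S.start (k + 1) = S.start k + 2 * S.size k :=
  Finset.sum_range_succ _ _

theorem start_mono : Monotone S.start :=
  monotone_nat_of_le_succ fun k => by rw [start_succ]; omega

theorem phase_le (t : ℕ) : S.phase t ≤ S.numPhases := Nat.findGreatest_le _

theorem start_phase_le (t : ℕ) : S.start (S.phase t) ≤ t :=
  Nat.findGreatest_spec (P := fun k => S.start k ≤ t) (Nat.zero_le S.numPhases) (by simp [start])

theorem lt_start_of_phase_lt {t k : ℕ} (h : S.phase t < k) (hk : k ≤ S.numPhases) :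
    t < S.start k :=
  not_le.1 (Nat.findGreatest_is_greatest (P := fun k => S.start k ≤ t) h hk)

theorem phase_eq {t k : ℕ} (hk : k < S.numPhases) (h1 : S.start k ≤ t)
    (h2 : t < S.start (k + 1)) : S.phase t = k := by
  refine le_antisymm ?_ (Nat.le_findGreatest hk.le h1)
  by_contra! h
  have : S.start (k + 1) ≤ S.start (S.phase t) := S.start_mono h
  have := S.start_phase_le t
  omega

theorem sum_explored {k : ℕ} (hk : k < S.numPhases) (f : Fin 2 → ℝ) :
    ∑ t ∈ Finset.Ico (S.start k) (S.start (k + 1)), f (S.explored t) =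
      S.size k * (f 0 + f 1) := by
  have h := S.start_succ k
  rw [← Finset.sum_Ico_consecutive _ (Nat.le_add_right (S.start k) (S.size k)) (by omega),
    Finset.sum_congr rfl (g := fun _ => f 0), Finset.sum_congr (s₁ := Finset.Ico (_ + _) _) rfl
    (g := fun _ => f 1)]
  · rw [Finset.sum_const, Finset.sum_const, Nat.card_Ico, Nat.card_Ico, h,
      show S.start k + S.size k - S.start k = S.size k by omega,
      show S.start k + 2 * S.size k - (S.start k + S.size k) = S.size k by omega]
    simp only [nsmul_eq_mul]
    ring
  · intro t ht
    rw [Finset.mem_Ico] at ht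
    rw [explored, S.phase_eq hk (by omega) (by omega), if_pos ht.1]
  · intro t ht
    rw [Finset.mem_Ico] at ht
    rw [explored, S.phase_eq hk (by omega) (by omega), if_neg (by omega)]

variable (p : PricePair)

/-- Weight of an observed demand in the comparison of the prices. -/
noncomputable def weight (k : Fin 2) : ℝ := if k = 1 then p.val 1 else -p.val 0

/-- Difference of the total rewards of the two prices in a phase, in terms of the observed
demands. -/
noncomputable def stat (k : ℕ) (x : ℕ → ℝ) : ℝ :=
  ∑ t ∈ Finset.Ico (S.start k) (S.start (k + 1)), weight p (S.explored t) * x t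

/-- The decision taken before phase `k`: `1` for the higher price, `-1` for the lower price, and
`0` as long as the policy explores. -/
noncomputable def decision : ℕ → (ℕ → ℝ) → ℤ
  | 0, _ => 0
  | k + 1, x =>
    if decision k x ≠ 0 then decision k x
    else if S.size k * S.tol k < S.stat p k x then 1
    else if S.stat p k x < -(S.size k * S.tol k) then -1 else 0

/-- The price set at time step `t`, in terms of the observed demands. -/
noncomputable def price (t : ℕ) (x : ℕ → ℝ) : Fin 2 :=
  if S.decision p (S.phase t) x = 1 then 1
  else if S.decision p (S.phase t) x = -1 then 0 else S.explored t

variable {S p}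

theorem decision_mem (k : ℕ) (x : ℕ → ℝ) :
    S.decision p k x = 0 ∨ S.decision p k x = 1 ∨ S.decision p k x = -1 := by
  induction k with
  | zero => exact Or.inl rfl
  | succ k ih =>
    rw [decision]
    split_ifs <;> simp_all

/-- A commitment is never revised. -/
theorem decision_eq_of_le {k l : ℕ} (h : k ≤ l) {x : ℕ → ℝ} (hk : S.decision p k x ≠ 0) :
    S.decision p l x = S.decision p k x := by
  induction l, h using Nat.le_induction with
  | base => rfl
  | succ l _ ih => rw [decision, if_pos (by rwa [ih]), ih]

theorem price_of_decision_eq_zero {t : ℕ} {x : ℕ → ℝ} (h : S.decision p (S.phase t) x = 0) :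
    S.price p t x = S.explored t := by
  simp [price, h]

/-- Demands matter to the decision only as long as it is open. -/
theorem decision_congr {k : ℕ} {x y : ℕ → ℝ}
    (h : ∀ j < k, S.decision p j y = 0 →
      ∀ t ∈ Finset.Ico (S.start j) (S.start (j + 1)), x t = y t) :
    S.decision p k x = S.decision p k y := by
  induction k with
  | zero => rfl
  | succ k ih =>
    have e := ih fun j hj => h j (hj.trans (Nat.lt_succ_self k))
    rw [decision, decision, e]
    by_cases h0 : S.decision p k y = 0
    · have : S.stat p k x = S.stat p k y :=
        Finset.sum_congr rfl fun t ht => by rw [h k (Nat.lt_succ_self k) h0 t ht]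
      rw [this]
    · simp [h0]

theorem measurable_decision (k : ℕ) : Measurable (S.decision p k) := by
  induction k with
  | zero => exact measurable_const
  | succ k ih =>
    have hs : Measurable (S.stat p k) := Finset.measurable_sum _ fun t _ =>
      (measurable_pi_apply t).const_mul _
    exact Measurable.ite (ih (measurableSet_singleton (0 : ℤ)).compl) ih
      (Measurable.ite (measurableSet_lt measurable_const hs) measurable_const
        (Measurable.ite (measurableSet_lt hs measurable_const) measurable_const measurable_const))

theorem measurable_price (t : ℕ) : Measurable (S.price p t) :=
  Measurable.ite (measurable_decision _ (measurableSet_singleton (1 : ℤ))) measurable_const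
    (Measurable.ite (measurable_decision _ (measurableSet_singleton (-1 : ℤ))) measurable_const
      measurable_const)

/-- The demands recorded in a history, continued by zeros. -/
noncomputable def observed {t : ℕ} (h : Fin t → Fin 2 × unitInterval) (s : ℕ) : ℝ :=
  if hs : s < t then ((h ⟨s, hs⟩).2 : ℝ) else 0

theorem measurable_observed {t : ℕ} :
    Measurable (observed : (Fin t → Fin 2 × unitInterval) → ℕ → ℝ) := by
  refine measurable_pi_iff.2 fun s => ?_
  unfold observed
  split_ifs
  · exact measurable_subtype_coe.comp (measurable_snd.comp (measurable_pi_apply _))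
  · exact measurable_const

variable (S p)

/-- The deterministic policy that follows a schedule of exploration phases. -/
noncomputable def policy : Policy where
  Seed := Unit
  seedLaw := Measure.dirac ()
  choose := fun t x => S.price p t (observed x.2)
  measurable_choose := fun t =>
    (measurable_price t).comp (measurable_observed.comp measurable_snd)

/-- The demands under the explored prices. -/
noncomputable def exploredDemand (D : ℕ → Fin 2 → unitInterval) (t : ℕ) : ℝ := D t (S.explored t)

/-- The prices set depend on the demands under the explored prices only. -/
theorem chosen_policy (ω : (S.policy p).Seed) (D : ℕ → Fin 2 → unitInterval) (t : ℕ) :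
    chosen (S.policy p) ω D t = S.price p t (S.exploredDemand D) := by
  induction t using Nat.strong_induction_on with
  | _ t ih =>
    change S.price p t (observed (history (S.policy p) ω D t)) = _
    have : S.decision p (S.phase t) (observed (history (S.policy p) ω D t)) =
        S.decision p (S.phase t) (S.exploredDemand D) := by
      refine decision_congr fun j hj h0 s hs => ?_
      rw [Finset.mem_Ico] at hs
      have h1 := S.start_mono (Nat.succ_le_of_lt hj)
      have h2 := S.start_phase_le t
      have hst : s < t := by simp only [Nat.succ_eq_add_one] at h1; omega
      have hj' := S.phase_le t
      have hphase : S.phase s = j := S.phase_eq (by omega) hs.1 hs.2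
      rw [observed, dif_pos hst, history_apply]
      simp only
      rw [ih s hst, price_of_decision_eq_zero (by rwa [hphase]), exploredDemand]
    simp only [price, this]

variable {S p}

/-! ### Refunds of batched elimination -/

/-- Within a phase the policy does not return to the lower price. -/
theorem price_eq_one_of_phase_eq {s t : ℕ} (hst : s ≤ t) (h : S.phase s = S.phase t) {x : ℕ → ℝ}
    (hs : S.price p s x = 1) : S.price p t x = 1 := by
  by_cases h1 : S.decision p (S.phase t) x = 1
  · rw [price, if_pos h1]
  have h2 : S.decision p (S.phase t) x ≠ -1 := fun h2 => by
    rw [price, h, if_neg h1, if_pos h2] at hs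
    exact absurd hs (by decide)
  rw [price, h, if_neg h1, if_neg h2, explored, h] at hs
  rw [price, if_neg h1, if_neg h2, explored]
  refine if_pos ?_
  by_contra h3
  rw [if_neg (by omega)] at hs
  exact absurd hs (by decide)

/-- A refund is caused by a return to the lower price, which happens at the start of a phase
only. -/
theorem exists_start_of_mem_refunded {T M t : ℕ} {x : ℕ → ℝ}
    (ht : t ∈ refunded T M fun s => S.price p s x) :
    ∃ k < S.numPhases, t < S.start (k + 1) ∧ S.start (k + 1) ≤ t + M := by
  simp only [refunded, Finset.mem_filter] at ht
  obtain ⟨-, h1, s, -, hts, hsM, h0⟩ := ht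
  have hlt : S.phase t < S.phase s := by
    by_contra! hle
    have hge : S.phase t ≤ S.phase s :=
      Nat.le_findGreatest (S.phase_le t) ((S.start_phase_le t).trans hts)
    have := price_eq_one_of_phase_eq hts (le_antisymm hge hle) h1
    rw [h0] at this
    exact absurd this (by decide)
  have hs := S.phase_le s
  refine ⟨S.phase s - 1, by omega, ?_, ?_⟩ <;> rw [Nat.sub_add_cancel (by omega)]
  · exact S.lt_start_of_phase_lt hlt hs
  · exact (S.start_phase_le s).trans hsM

/-- At most `M` customers are refunded because of the start of a given phase. -/
theorem card_refunded_le_mul (T M : ℕ) (x : ℕ → ℝ) :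
    (refunded T M fun s => S.price p s x).card ≤ S.numPhases * M := by
  have hsub : (refunded T M fun s => S.price p s x) ⊆ (Finset.range S.numPhases).biUnion
      fun k => Finset.Ico (S.start (k + 1) - M) (S.start (k + 1)) := by
    intro t ht
    obtain ⟨k, hk, h1, h2⟩ := exists_start_of_mem_refunded ht
    exact Finset.mem_biUnion.2 ⟨k, Finset.mem_range.2 hk, Finset.mem_Ico.2 ⟨by omega, h1⟩⟩
  refine (Finset.card_le_card hsub).trans (Finset.card_biUnion_le.trans ?_)
  refine (Finset.sum_le_card_nsmul _ _ M fun k _ => ?_).trans (by simp)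
  rw [Nat.card_Ico]
  omega

theorem card_refunded_le_start (T M : ℕ) (x : ℕ → ℝ) :
    (refunded T M fun s => S.price p s x).card ≤ S.start S.numPhases := by
  have hsub : (refunded T M fun s => S.price p s x) ⊆ Finset.range (S.start S.numPhases) := by
    intro t ht
    obtain ⟨k, hk, h1, -⟩ := exists_start_of_mem_refunded ht
    exact Finset.mem_range.2 (h1.trans_le (S.start_mono hk))
  simpa using Finset.card_le_card hsub

end Schedule

/-- A refund is at most `1`, since prices and demands are. -/
theorem loss_le {T M : ℕ} (p : PricePair) (ν : Demand) (π : Policy)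
    (x : π.Seed × (Fin T → Fin 2 → unitInterval)) :
    loss M p ν π x ≤ (∑ t : Fin T, (max (meanReward p ν 0) (meanReward p ν 1) -
      meanReward p ν (chosen π x.1 (extend x.2) t))) +
      (refunded T M fun t => chosen π x.1 (extend x.2) t).card := by
  rw [card_refunded_eq_sum, ← Finset.sum_add_distrib, loss]
  refine Finset.sum_le_sum fun t _ => add_le_add le_rfl ?_
  split_ifs with h
  · have h1 := finalPrice_mem M p (fun s => chosen π x.1 (extend x.2) s) t
    have h2 := (p.mem (chosen π x.1 (extend x.2) t)).2
    have h3 := (x.2 t (chosen π x.1 (extend x.2) t)).2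
    exact mul_le_one₀ (by linarith [h1.1]) h3.1 h3.2
  · rw [finalPrice_eq_of_notMem_refunded p _ t h, sub_self, zero_mul]

namespace Schedule

variable {S : Schedule} {p : PricePair}

/-! ### Concentration within a phase -/

theorem weight_mul_meanDemand (p : PricePair) (ν : Demand) :
    weight p 0 * meanDemand ν 0 + weight p 1 * meanDemand ν 1 =
      meanReward p ν 1 - meanReward p ν 0 := by
  simp [weight, meanReward]
  ring

theorem abs_weight_le (p : PricePair) (k : Fin 2) : |weight p k| ≤ 1 := by
  unfold weight
  split_ifs
  · rw [abs_of_nonneg (p.mem 1).1]; exact (p.mem 1).2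
  · rw [abs_neg, abs_of_nonneg (p.mem 0).1]; exact (p.mem 0).2

theorem sum_Ico_eq_sum_fin {T a b : ℕ} (hb : b ≤ T) (f : ℕ → ℝ) :
    ∑ t ∈ Finset.Ico a b, f t =
      ∑ t ∈ Finset.univ.filter (fun t : Fin T => a ≤ (t : ℕ) ∧ (t : ℕ) < b), f t := by
  rw [Finset.sum_filter, Fin.sum_univ_eq_sum_range (fun t => if a ≤ t ∧ t < b then f t else 0) T,
    ← Finset.sum_filter]
  congr 1
  ext t
  simp only [Finset.mem_Ico, Finset.mem_filter, Finset.mem_range]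
  omega

/-- Hoeffding's inequality for the comparison of the two prices within a phase. -/
theorem measureReal_stat_le {T : ℕ} (ν : Demand) {k : ℕ} (hk : k < S.numPhases)
    (hT : S.start (k + 1) ≤ T) (hn : 1 ≤ S.size k) {e Δ a : ℝ} (he : |e| = 1)
    (hΔ : e * (meanReward p ν 1 - meanReward p ν 0) = Δ) (ha : a ≤ Δ) :
    (demandLaw T ν).real {D | e * S.stat p k (S.exploredDemand (extend D)) ≤ S.size k * a} ≤
      Real.exp (-(S.size k * (Δ - a) ^ 2)) := by
  -- The summands are normalized to range over an interval of length `1`, and the event is that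
  -- their centred sum is large.
  set γ : ℕ → ℝ := fun t => -(e * weight p (S.explored t)) with hγ
  have hγ1 (t : ℕ) : |γ t| ≤ 1 := by
    rw [hγ]
    simp only [abs_neg, abs_mul, he, one_mul]
    exact abs_weight_le p _
  set X : ℕ → (Fin 2 → unitInterval) → ℝ := fun t r =>
    γ t * r (S.explored t) - γ t * meanDemand ν (S.explored t) with hX
  have hXm (t : ℕ) : Measurable (X t) :=
    ((measurable_subtype_coe.comp (measurable_pi_apply _)).const_mul _).sub_const _
  have hind : ProbabilityTheory.iIndepFun (fun (t : Fin T) (D : Fin T → Fin 2 → unitInterval) =>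
      X t (D t)) (demandLaw T ν) :=
    ProbabilityTheory.iIndepFun_pi (μ := fun _ : Fin T => rowLaw ν)
      fun t => (hXm t).aemeasurable
  have hsub (t : Fin T) : ProbabilityTheory.HasSubgaussianMGF
      (fun D : Fin T → Fin 2 → unitInterval => X t (D t)) ((1 / 2) ^ 2) (demandLaw T ν) := by
    have hm : Measurable fun D : Fin T → Fin 2 → unitInterval =>
        γ t * (D t (S.explored t) : ℝ) :=
      (measurable_subtype_coe.comp
        ((measurable_pi_apply _).comp (measurable_pi_apply t))).const_mul _
    have h := ProbabilityTheory.hasSubgaussianMGF_of_mem_Icc (μ := demandLaw T ν)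
      (a := min (γ t) 0) (b := min (γ t) 0 + 1) hm.aemeasurable
      (Filter.Eventually.of_forall fun D => by
        have h1 := (D t (S.explored t)).2
        have h2 := abs_le.1 (hγ1 t)
        rcases le_total (γ t) 0 with h | h
        · rw [min_eq_left h]
          constructor <;> nlinarith [h1.1, h1.2]
        · rw [min_eq_right h]
          constructor <;> nlinarith [h1.1, h1.2])
    have hmean : ∫ D : Fin T → Fin 2 → unitInterval, γ t * (D t (S.explored t) : ℝ) ∂demandLaw T ν =
        γ t * meanDemand ν (S.explored t) := by
      rw [integral_const_mul]
      congr 1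
      have h1 := measurePreserving_eval (fun _ : Fin T => rowLaw ν) t
      have h2 : Measurable fun r : Fin 2 → unitInterval => (r (S.explored t) : ℝ) :=
        measurable_subtype_coe.comp (measurable_pi_apply _)
      have h3 := integral_rowLaw_apply ν (S.explored t) measurable_subtype_coe
      rw [← h1.map_eq, integral_map h1.measurable.aemeasurable h2.aestronglyMeasurable] at h3
      exact h3
    rw [hmean] at h
    simpa [hX] using h
  set s := Finset.univ.filter fun t : Fin T => S.start k ≤ (t : ℕ) ∧ (t : ℕ) < S.start (k + 1)
    with hs
  have hcard : (s.card : ℝ) = 2 * S.size k := by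
    have h1 := sum_Ico_eq_sum_fin (T := T) (a := S.start k) hT fun _ => 1
    simp only [Finset.sum_const, nsmul_eq_mul, mul_one, Nat.card_Ico] at h1
    rw [hs, ← h1, start_succ, Nat.add_sub_cancel_left]
    push_cast
    ring
  have hsum (D : Fin T → Fin 2 → unitInterval) : ∑ t ∈ s, X t (D t) =
      S.size k * Δ - e * S.stat p k (S.exploredDemand (extend D)) := by
    have h1 : ∑ t ∈ s, X t (D t) = ∑ t ∈ s, X t (extend D t) :=
      Finset.sum_congr rfl fun t _ => by rw [extend_apply]
    rw [h1, ← sum_Ico_eq_sum_fin hT fun t => X t (extend D t), hX]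
    simp only [hγ]
    rw [Finset.sum_sub_distrib, S.sum_explored hk fun i => -(e * weight p i) * meanDemand ν i,
      stat, Finset.mul_sum, ← hΔ, ← weight_mul_meanDemand, sub_eq_add_neg, sub_eq_add_neg, add_comm,
      ← Finset.sum_neg_distrib]
    congr 1
    · ring
    · exact Finset.sum_congr rfl fun t _ => by rw [exploredDemand]; ring
  have hn' : (0 : ℝ) < S.size k := by exact_mod_cast hn
  have key := ProbabilityTheory.HasSubgaussianMGF.measure_sum_ge_le_of_iIndepFun hind
    (s := s) (fun t _ => hsub t) (ε := S.size k * (Δ - a))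
    (mul_nonneg hn'.le (sub_nonneg.2 ha))
  refine (le_of_eq ?_).trans (key.trans (le_of_eq ?_))
  · congr 1
    ext D
    simp only [Set.mem_ofPred_eq, hsum]
    constructor <;> intro h <;> linarith
  · congr 1
    rw [Finset.sum_const, nsmul_eq_mul]
    push_cast
    rw [hcard]
    field_simp

theorem mul_exp_neg_mul_sq_le {n : ℝ} (hn : 0 < n) (Δ : ℝ) :
    Δ * Real.exp (-(n * Δ ^ 2)) ≤ 1 / √n := by
  have hs : 0 < √n := Real.sqrt_pos.2 hn
  have h1 : n * Δ ^ 2 = (√n * Δ) ^ 2 := by rw [mul_pow, Real.sq_sqrt hn.le]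
  rw [h1, le_div_iff₀ hs, Real.exp_neg, mul_right_comm, ← div_eq_mul_inv,
    div_le_one (Real.exp_pos _)]
  have := Real.add_one_le_exp ((√n * Δ) ^ 2)
  nlinarith [sq_nonneg (√n * Δ - 1)]

/-- If the policy has not stopped in a phase, then the gap is small or the comparison in this phase
was far off. -/
theorem mul_measureReal_decision_succ_eq_zero_le {T : ℕ} (ν : Demand) {k : ℕ}
    (hk : k < S.numPhases) (hT : S.start (k + 1) ≤ T) (hn : 1 ≤ S.size k) (hθ : 0 ≤ S.tol k)
    {e Δ : ℝ} (he : |e| = 1) (hΔ : e * (meanReward p ν 1 - meanReward p ν 0) = Δ) (hΔ0 : 0 ≤ Δ) :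
    Δ * (demandLaw T ν).real
      {D | S.decision p (k + 1) (S.exploredDemand (extend D)) = 0} ≤
      2 * S.tol k + 2 / √(S.size k) := by
  have hn' : (0 : ℝ) < S.size k := by exact_mod_cast hn
  have hs : 0 < √(S.size k : ℝ) := Real.sqrt_pos.2 hn'
  -- A gap below twice the tolerance need not be detected, but is small itself.
  rcases le_total Δ (2 * S.tol k) with h | h
  · refine le_add_of_le_of_nonneg ?_ (by positivity)
    exact (mul_le_of_le_one_right hΔ0 measureReal_le_one).trans h
  · have hsub : {D : Fin T → Fin 2 → unitInterval |
        S.decision p (k + 1) (S.exploredDemand (extend D)) = 0} ⊆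
        {D | e * S.stat p k (S.exploredDemand (extend D)) ≤ S.size k * S.tol k} := by
      intro D hD
      simp only [Set.mem_ofPred_eq, decision] at hD ⊢
      split_ifs at hD with h1 h2 h3
      all_goals first
        | exact absurd hD h1
        | exact absurd hD (by decide)
        | rcases eq_or_eq_neg_of_abs_eq he with he | he <;> rw [he] <;> linarith
    have h1 := (measureReal_mono hsub).trans
      (measureReal_stat_le ν hk hT hn he hΔ (show S.tol k ≤ Δ by linarith))
    have h2 : Real.exp (-(S.size k * (Δ - S.tol k) ^ 2)) ≤
        Real.exp (-(S.size k * (Δ / 2) ^ 2)) := by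
      refine Real.exp_le_exp.2 (neg_le_neg (mul_le_mul_of_nonneg_left ?_ hn'.le))
      exact pow_le_pow_left₀ (by linarith) (by linarith) 2
    have h3 := mul_exp_neg_mul_sq_le hn' (Δ / 2)
    have h4 := mul_le_mul_of_nonneg_left (h1.trans h2) hΔ0
    have h5 : 2 / √(S.size k : ℝ) = 2 * (1 / √(S.size k : ℝ)) := by ring
    rw [h5]
    linarith

/-- The policy rarely commits to the worse price. -/
theorem mul_measureReal_decision_eq_le {T : ℕ} (ν : Demand) (hT : S.start S.numPhases ≤ T)
    (hn : ∀ k, k < S.numPhases → 1 ≤ S.size k) (hθ : ∀ k, k < S.numPhases → 0 ≤ S.tol k)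
    {e : ℤ} {Δ : ℝ} (he : |(e : ℝ)| = 1)
    (hΔ : e * (meanReward p ν 1 - meanReward p ν 0) = Δ) (hΔ0 : 0 ≤ Δ) {l : ℕ}
    (hl : l ≤ S.numPhases) :
    Δ * (demandLaw T ν).real {D | S.decision p l (S.exploredDemand (extend D)) = -e} ≤
      ∑ k ∈ Finset.range l, Real.exp (-(S.size k * S.tol k ^ 2)) / √(S.size k) := by
  induction l with
  | zero =>
    have : (0 : ℤ) ≠ -e := by
      rintro h
      have : e = 0 := by omega
      simp [this] at he
    simp [decision, this]
  | succ l ih =>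
    have hll : l < S.numPhases := hl
    have hn' : (0 : ℝ) < S.size l := by exact_mod_cast hn l hll
    have hsub : {D : Fin T → Fin 2 → unitInterval |
        S.decision p (l + 1) (S.exploredDemand (extend D)) = -e} ⊆
        {D | S.decision p l (S.exploredDemand (extend D)) = -e} ∪
        {D | e * S.stat p l (S.exploredDemand (extend D)) ≤ S.size l * -S.tol l} := by
      intro D hD
      simp only [Set.mem_union, Set.mem_ofPred_eq, decision] at hD ⊢
      split_ifs at hD with h1 h2 h3
      · exact Or.inl hD
      · have : e = -1 := by omega
        subst this
        right
        push_cast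
        linarith
      · have : e = 1 := by omega
        subst this
        right
        push_cast
        linarith
      · have : e = 0 := by omega
        simp [this] at he
    have h1 := (measureReal_mono (μ := demandLaw T ν) hsub).trans (measureReal_union_le _ _)
    have h2 := measureReal_stat_le ν hll ((S.start_mono hl).trans hT) (hn l hll) he hΔ
      (show -S.tol l ≤ Δ by linarith [hθ l hll])
    have h3 : Real.exp (-(S.size l * (Δ - -S.tol l) ^ 2)) ≤
        Real.exp (-(S.size l * Δ ^ 2)) * Real.exp (-(S.size l * S.tol l ^ 2)) := by
      rw [← Real.exp_add]
      refine Real.exp_le_exp.2 ?_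
      have := mul_nonneg hn'.le (mul_nonneg hΔ0 (hθ l hll))
      nlinarith
    have h4 := mul_le_mul_of_nonneg_right (mul_exp_neg_mul_sq_le hn' Δ)
      (Real.exp_pos (-(S.size l * S.tol l ^ 2))).le
    have h5 := mul_le_mul_of_nonneg_left (h1.trans (add_le_add le_rfl (h2.trans h3))) hΔ0
    rw [Finset.sum_range_succ, div_eq_mul_one_div (Real.exp _) √(S.size l : ℝ)]
    linarith [ih hll.le]

/-! ### Regret of batched elimination -/

/-- Bound for the product of the gap and the probability that the policy has not committed to a
price before phase `k`. -/
noncomputable def exploreBound (S : Schedule) : ℕ → ℝ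
  | 0 => 1
  | k + 1 => 2 * S.tol k + 2 / √(S.size k)

theorem measureReal_decision_eq_zero_le {T : ℕ} (ν : Demand) (hT : S.start S.numPhases ≤ T)
    (hn : ∀ k, k < S.numPhases → 1 ≤ S.size k) (hθ : ∀ k, k < S.numPhases → 0 ≤ S.tol k)
    {e Δ : ℝ} (he : |e| = 1) (hΔ : e * (meanReward p ν 1 - meanReward p ν 0) = Δ) (hΔ0 : 0 ≤ Δ)
    {k : ℕ} (hk : k ≤ S.numPhases) :
    Δ * (demandLaw T ν).real {D | S.decision p k (S.exploredDemand (extend D)) = 0} ≤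
      S.exploreBound k := by
  cases k with
  | zero =>
    refine (mul_le_of_le_one_right hΔ0 measureReal_le_one).trans ?_
    have h0 := meanReward_mem p ν 0
    have h1 := meanReward_mem p ν 1
    rw [← hΔ]
    refine (le_abs_self _).trans ?_
    rw [abs_mul, he, one_mul, exploreBound]
    exact abs_le.2 ⟨by linarith [h0.1, h0.2, h1.1, h1.2], by linarith [h0.1, h0.2, h1.1, h1.2]⟩
  | succ k =>
    exact mul_measureReal_decision_succ_eq_zero_le ν hk ((S.start_mono hk).trans hT) (hn k hk)
      (hθ k hk) he hΔ hΔ0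

/-- A time step is wasted only if the policy commits to the worse price, never commits, or still
explores. Here the better price is the higher one if `e = 1` and the lower one if `e = -1`. -/
theorem max_sub_meanReward_price_le (t : ℕ) (ν : Demand)
    {e : ℤ} {Δ : ℝ} (he : e = 1 ∨ e = -1)
    (hΔ : e * (meanReward p ν 1 - meanReward p ν 0) = Δ) (hΔ0 : 0 ≤ Δ) (x : ℕ → ℝ) :
    max (meanReward p ν 0) (meanReward p ν 1) - meanReward p ν (S.price p t x) ≤
      Δ * ((if S.decision p S.numPhases x = -e then 1 else 0) +
        (if S.decision p S.numPhases x = 0 then 1 else 0) +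
        if t < S.start S.numPhases ∧ S.decision p (S.phase t) x = 0 then 1 else 0) := by
  have hle : max (meanReward p ν 0) (meanReward p ν 1) - meanReward p ν (S.price p t x) ≤ Δ := by
    generalize S.price p t x = k
    rcases Fin.exists_fin_two.1 ⟨k, rfl⟩ with hk | hk <;> rcases he with he | he <;>
      subst hk he <;> push_cast at hΔ <;>
      rcases max_cases (meanReward p ν 0) (meanReward p ν 1) with h | h <;> linarith [h.1, h.2]
  by_cases h0 : S.decision p (S.phase t) x = 0
  · refine hle.trans (le_mul_of_one_le_right hΔ0 ?_)
    rcases (S.phase_le t).lt_or_eq with h | h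
    · rw [if_pos (⟨S.lt_start_of_phase_lt h le_rfl, h0⟩ : _ ∧ _)]
      refine le_add_of_nonneg_left ?_
      split_ifs <;> norm_num
    · rw [h] at h0
      rw [if_pos h0]
      split_ifs <;> norm_num
  have hK := decision_eq_of_le (S.phase_le t) h0
  by_cases h1 : S.decision p (S.phase t) x = -e
  · refine hle.trans (le_mul_of_one_le_right hΔ0 ?_)
    rw [hK, if_pos h1]
    split_ifs <;> norm_num
  · have hr : 0 ≤ Δ * ((if S.decision p S.numPhases x = -e then 1 else 0) +
        (if S.decision p S.numPhases x = 0 then 1 else 0) +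
        if t < S.start S.numPhases ∧ S.decision p (S.phase t) x = 0 then 1 else 0) := by
      refine mul_nonneg hΔ0 ?_
      split_ifs <;> norm_num
    refine le_trans (le_of_eq ?_) hr
    rw [sub_eq_zero]
    rcases he with he | he <;> subst he <;> push_cast at hΔ
    · have h2 : S.decision p (S.phase t) x = 1 := by
        rcases decision_mem (S := S) (p := p) (S.phase t) x with h | h | h <;> simp_all
      rw [price, if_pos h2]
      exact max_eq_right (by linarith)
    · have h2 : S.decision p (S.phase t) x = -1 := by
        rcases decision_mem (S := S) (p := p) (S.phase t) x with h | h | h <;> simp_all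
      rw [price, if_neg (by rw [h2]; decide), if_pos h2]
      exact max_eq_left (by linarith)

/-- Phase `k` consists of `2 * size k` time steps. -/
theorem sum_phase {l : ℕ} (hl : l ≤ S.numPhases) (g : ℕ → ℝ) :
    ∑ t ∈ Finset.range (S.start l), g (S.phase t) =
      ∑ k ∈ Finset.range l, 2 * S.size k * g k := by
  induction l with
  | zero => simp [start]
  | succ l ih =>
    rw [Finset.sum_range_succ, ← ih (by omega), Finset.range_eq_Ico, Finset.range_eq_Ico,
      ← Finset.sum_Ico_consecutive _ (Nat.zero_le _) (S.start_mono (Nat.le_succ l)),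
      Finset.sum_congr (s₁ := Finset.Ico (S.start l) _) rfl (g := fun _ => g l)]
    · rw [Finset.sum_const, Nat.card_Ico, Nat.succ_eq_add_one, start_succ,
        Nat.add_sub_cancel_left, nsmul_eq_mul]
      push_cast
      rfl
    · intro t ht
      rw [Finset.mem_Ico] at ht
      rw [S.phase_eq hl ht.1 ht.2]

theorem integral_ite_one_zero {α : Type*} [MeasurableSpace α] (μ : Measure α) {P : α → Prop}
    [DecidablePred P] (hP : MeasurableSet {x | P x}) :
    ∫ x, (if P x then (1 : ℝ) else 0) ∂μ = μ.real {x | P x} := by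
  rw [← integral_indicator_one hP]
  refine integral_congr_ae (Filter.Eventually.of_forall fun x => ?_)
  simp [Set.indicator_apply]

/-- Regret bound for a schedule of exploration phases, given a bound `b` for the refunds. -/
theorem regret_policy_le {T M : ℕ} (p : PricePair) (ν : Demand) (hT : S.start S.numPhases ≤ T)
    (hn : ∀ k, k < S.numPhases → 1 ≤ S.size k) (hθ : ∀ k, k < S.numPhases → 0 ≤ S.tol k) {b : ℝ}
    (hb : ∀ x, ((refunded T M fun s => S.price p s x).card : ℝ) ≤ b) :
    regret T M p ν (S.policy p) ≤
      (∑ k ∈ Finset.range S.numPhases, 2 * S.size k * S.exploreBound k) +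
      T * ((∑ k ∈ Finset.range S.numPhases,
        Real.exp (-(S.size k * S.tol k ^ 2)) / √(S.size k)) + S.exploreBound S.numPhases) + b := by
  obtain ⟨e, he, hΔ0⟩ : ∃ e : ℤ, (e = 1 ∨ e = -1) ∧
      0 ≤ e * (meanReward p ν 1 - meanReward p ν 0) := by
    rcases le_total (meanReward p ν 0) (meanReward p ν 1) with h | h
    · exact ⟨1, Or.inl rfl, by push_cast; linarith⟩
    · exact ⟨-1, Or.inr rfl, by push_cast; linarith⟩
  have he' : |(e : ℝ)| = 1 := by rcases he with rfl | rfl <;> simp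
  generalize hΔ : e * (meanReward p ν 1 - meanReward p ν 0) = Δ at hΔ0
  set P := demandLaw T ν with hP
  set X : (Fin T → Fin 2 → unitInterval) → ℕ → ℝ := fun D => S.exploredDemand (extend D) with hX
  have hXm : Measurable X := measurable_pi_iff.2 fun t => by
    have h : Measurable fun r : Fin 2 → unitInterval => (r (S.explored t) : ℝ) :=
      measurable_subtype_coe.comp (measurable_pi_apply _)
    exact h.comp ((measurable_pi_apply t).comp measurable_extend)
  have hdm (k : ℕ) (a : ℤ) : MeasurableSet {D | S.decision p k (X D) = a} :=
    ((measurable_decision k).comp hXm) (measurableSet_singleton a)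
  have hdt (t : ℕ) : MeasurableSet
      {D | t < S.start S.numPhases ∧ S.decision p (S.phase t) (X D) = 0} :=
    (MeasurableSet.const _).inter (hdm _ 0)
  set f1 : (Fin T → Fin 2 → unitInterval) → ℝ := fun D =>
    if S.decision p S.numPhases (X D) = -e then 1 else 0 with hf1
  set f2 : (Fin T → Fin 2 → unitInterval) → ℝ := fun D =>
    if S.decision p S.numPhases (X D) = 0 then 1 else 0 with hf2
  set f3 : ℕ → (Fin T → Fin 2 → unitInterval) → ℝ := fun t D =>
    if t < S.start S.numPhases ∧ S.decision p (S.phase t) (X D) = 0 then 1 else 0 with hf3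
  have i1 : Integrable f1 P := integrable_of_measurable_of_abs_le
    (Measurable.ite (hdm _ _) measurable_const measurable_const) 1 fun D => by
      rw [hf1]; dsimp only; split_ifs <;> simp
  have i2 : Integrable f2 P := integrable_of_measurable_of_abs_le
    (Measurable.ite (hdm _ _) measurable_const measurable_const) 1 fun D => by
      rw [hf2]; dsimp only; split_ifs <;> simp
  have i3 (t : ℕ) : Integrable (f3 t) P := integrable_of_measurable_of_abs_le
    (Measurable.ite (hdt t) measurable_const measurable_const) 1 fun D => by
      rw [hf3]; dsimp only; split_ifs <;> simp
  have i12 : Integrable (fun D => f1 D + f2 D) P := i1.add i2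
  have i4 (t : ℕ) : Integrable (fun D => Δ * (f1 D + f2 D + f3 t D)) P :=
    (i12.add (i3 t)).const_mul Δ
  have i5 : Integrable (fun D => ∑ t : Fin T, Δ * (f1 D + f2 D + f3 t D)) P :=
    integrable_finsetSum _ fun t _ => i4 t
  have i6 : Integrable (fun D => (∑ t : Fin T, Δ * (f1 D + f2 D + f3 t D)) + b) P :=
    i5.add (integrable_const b)
  have hloss (x : (S.policy p).Seed × (Fin T → Fin 2 → unitInterval)) :
      loss M p ν (S.policy p) x ≤ (∑ t : Fin T, Δ * (f1 x.2 + f2 x.2 + f3 t x.2)) + b := by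
    refine (loss_le p ν (S.policy p) x).trans (add_le_add (Finset.sum_le_sum fun t _ => ?_) ?_)
    · rw [chosen_policy]
      exact max_sub_meanReward_price_le t ν he hΔ hΔ0 _
    · simp only [chosen_policy]
      exact hb _
  have hterm (t : ℕ) : ∫ D, Δ * (f1 D + f2 D + f3 t D) ∂P ≤
      ((∑ k ∈ Finset.range S.numPhases, Real.exp (-(S.size k * S.tol k ^ 2)) / √(S.size k)) +
        S.exploreBound S.numPhases) +
        if t < S.start S.numPhases then S.exploreBound (S.phase t) else 0 := by
    rw [integral_const_mul, integral_add i12 (i3 t), integral_add i1 i2, mul_add, mul_add]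
    refine add_le_add (add_le_add ?_ ?_) ?_
    · rw [hf1, integral_ite_one_zero P (hdm _ _)]
      exact mul_measureReal_decision_eq_le ν hT hn hθ he' hΔ hΔ0 le_rfl
    · rw [hf2, integral_ite_one_zero P (hdm _ _)]
      exact measureReal_decision_eq_zero_le ν hT hn hθ he' hΔ hΔ0 le_rfl
    · by_cases ht : t < S.start S.numPhases
      · simp only [hf3, ht, true_and, if_true]
        rw [integral_ite_one_zero P (hdm _ _)]
        exact measureReal_decision_eq_zero_le ν hT hn hθ he' hΔ hΔ0 (S.phase_le t)
      · simp [hf3, ht]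
  rw [regret_eq_integral_loss]
  refine (integral_mono (integrable_loss M p ν ν (S.policy p)) (i6.comp_snd _) hloss).trans ?_
  rw [integral_fun_snd (fun D => (∑ t : Fin T, Δ * (f1 D + f2 D + f3 t D)) + b), probReal_univ,
    one_smul, ← hP, integral_add i5 (integrable_const b),
    integral_finsetSum _ fun (t : Fin T) _ => i4 t, integral_const, probReal_univ, one_smul]
  refine add_le_add ((Finset.sum_le_sum fun (t : Fin T) _ => hterm t).trans (le_of_eq ?_)) le_rfl
  rw [Finset.sum_add_distrib, Finset.sum_const, Finset.card_univ, Fintype.card_fin, nsmul_eq_mul,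
    add_comm, ← sum_phase le_rfl, Fin.sum_univ_eq_sum_range (fun t =>
      if t < S.start S.numPhases then S.exploreBound (S.phase t) else 0) T, ← Finset.sum_filter]
  congr 2
  ext t
  simp only [Finset.mem_filter, Finset.mem_range]
  omega

end Schedule

/-! ### The upper bound for long protection periods -/

/-- A single phase of size of order `T ^ (2 / 3)` with tolerance `0`. All refunds go to customers of
this phase. -/
theorem optRegret_le_rpow {T : ℕ} (M : ℕ) (hT : 3 ≤ T) :
    optRegret T M ≤ 8 * (T : ℝ) ^ (2 / 3 : ℝ) := by
  have hT0 : (0 : ℝ) < T := by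
    have : 0 < T := by omega
    exact_mod_cast this
  set z := (T : ℝ) ^ (1 / 3 : ℝ) with hz
  have hz0 : 0 < z := Real.rpow_pos_of_pos hT0 _
  have hz2 : (T : ℝ) ^ (2 / 3 : ℝ) = z ^ 2 := by
    rw [hz, ← Real.rpow_natCast, ← Real.rpow_mul hT0.le]
    norm_num
  have hz3 : (T : ℝ) = z ^ 3 := by
    rw [hz, ← Real.rpow_natCast, ← Real.rpow_mul hT0.le]
    norm_num
  rw [hz2]
  rcases le_total z 2 with h2 | h2
  · refine (optRegret_le_horizon T M).trans ?_
    rw [hz3]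
    nlinarith [pow_pos hz0 2]
  have hn1 : 1 ≤ ⌊z ^ 2 / 2⌋₊ := Nat.le_floor (by norm_num; nlinarith)
  have hle : (⌊z ^ 2 / 2⌋₊ : ℝ) ≤ z ^ 2 / 2 := Nat.floor_le (by positivity)
  have hge : z ^ 2 / 2 < ⌊z ^ 2 / 2⌋₊ + 1 := Nat.lt_floor_add_one _
  set n := ⌊z ^ 2 / 2⌋₊ with hn
  have hn1' : (1 : ℝ) ≤ n := by exact_mod_cast hn1
  have hsqrt : z / 2 ≤ √(n : ℝ) := Real.le_sqrt_of_sq_le (by nlinarith)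
  have hinv : 1 / √(n : ℝ) ≤ 2 / z := by
    rw [div_le_div_iff₀ (by linarith) hz0]
    linarith
  have hstart : (Schedule.mk 1 (fun _ => n) fun _ => 0).start 1 = 2 * n := by
    simp [Schedule.start]
  refine optRegret_le (fun p => (Schedule.mk 1 (fun _ => n) fun _ => 0).policy p) fun p ν => ?_
  refine (Schedule.regret_policy_le (b := 2 * n) p ν ?_ (fun _ _ => hn1) (fun _ _ => le_rfl)
    fun x => ?_).trans ?_
  · rw [hstart]
    have : (2 : ℝ) * n ≤ T := by rw [hz3]; nlinarith [pow_pos hz0 2]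
    exact_mod_cast this
  · have := Schedule.card_refunded_le_start (S := Schedule.mk 1 (fun _ => n) fun _ => 0) (p := p)
      T M x
    rw [hstart] at this
    exact_mod_cast this
  · simp only [Finset.sum_range_one, Schedule.exploreBound]
    have e : z ^ 3 * (3 * (2 / z)) = 6 * z ^ 2 := by field_simp; norm_num
    have h3 := mul_le_mul_of_nonneg_left (mul_le_mul_of_nonneg_left hinv (zero_le_three (α := ℝ)))
      (pow_pos hz0 3).le
    rw [e] at h3
    rw [hz3]
    have e2 : 2 / √(n : ℝ) = 2 * (1 / √(n : ℝ)) := by ring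
    rw [e2]
    norm_num
    norm_num at h3
    linarith

/-! ### The upper bound for short protection periods -/

/-- In reversed order the phase sizes are `T / (16 x)` with `x = exp ((4/3) ^ j)`, so that
`J + 1` phases, where `J` is of order `log (log T)`, lead from phases of size at most `√T` to phases
of size proportional to `T`. The factor `16` makes all phases fit into the horizon `T`. The
tolerance makes the risk of committing to the worse price in a phase at most `1 / x`. -/
noncomputable def doublyExponential (T J : ℕ) : Schedule where
  numPhases := J + 1
  size := fun k => ⌊T / (16 * Real.exp ((4 / 3) ^ (J - k)))⌋₊
  tol := fun k => √((4 / 3) ^ (J - k) / ⌊T / (16 * Real.exp ((4 / 3) ^ (J - k)))⌋₊)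

section PhaseEstimates

variable {T a : ℝ}

theorem one_le_floor_phase (h : 16 * Real.exp a ≤ T) : 1 ≤ ⌊T / (16 * Real.exp a)⌋₊ :=
  Nat.le_floor (by rw [Nat.cast_one, le_div_iff₀ (by positivity)]; linarith)

theorem floor_phase_le (h : 0 ≤ T) : (⌊T / (16 * Real.exp a)⌋₊ : ℝ) ≤ T / (16 * Real.exp a) :=
  Nat.floor_le (by positivity)

theorem one_div_sqrt_floor_phase_le (h : 16 * Real.exp a ≤ T) :
    1 / √(⌊T / (16 * Real.exp a)⌋₊ : ℝ) ≤ 6 * Real.exp (a / 2) / √T := by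
  have hT : 0 < T := lt_of_lt_of_le (by positivity) h
  have h1 := one_le_floor_phase h
  have h2 := Nat.lt_floor_add_one (T / (16 * Real.exp a))
  set n := ⌊T / (16 * Real.exp a)⌋₊
  have hn : (1 : ℝ) ≤ n := by exact_mod_cast h1
  rw [div_lt_iff₀ (by positivity)] at h2
  have hs : 0 < √T := Real.sqrt_pos.2 hT
  have hsn : 0 < √(n : ℝ) := Real.sqrt_pos.2 (by linarith)
  rw [div_le_div_iff₀ hsn hs, one_mul]
  refine Real.sqrt_le_iff.2 ⟨by positivity, ?_⟩
  rw [mul_pow, mul_pow, Real.sq_sqrt (by linarith), ← Real.exp_nat_mul]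
  have e : ((2 : ℕ) : ℝ) * (a / 2) = a := by push_cast; ring
  rw [e]
  nlinarith [Real.exp_pos a]

theorem exploreBound_phase_le (ha : 1 ≤ a) (h : 16 * Real.exp a ≤ T) :
    2 * √(a / ⌊T / (16 * Real.exp a)⌋₊) + 2 / √(⌊T / (16 * Real.exp a)⌋₊ : ℝ) ≤
      24 * a * Real.exp (a / 2) / √T := by
  have h1 := one_div_sqrt_floor_phase_le h
  have h2 : √a ≤ a := Real.sqrt_le_iff.2 ⟨by linarith, by nlinarith⟩
  rw [Real.sqrt_div (by linarith)]
  set s := √(⌊T / (16 * Real.exp a)⌋₊ : ℝ)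
  have e1 : 2 * (√a / s) + 2 / s = (2 * √a + 2) * (1 / s) := by ring
  have e2 : 24 * a * Real.exp (a / 2) / √T = (4 * a) * (6 * Real.exp (a / 2) / √T) := by ring
  rw [e1, e2]
  exact mul_le_mul (by linarith) h1 (by positivity) (by linarith)

/-- The cost of a phase, given that the policy did not stop in the previous one. -/
theorem explore_cost_le (ha : 1 ≤ a) (h : 16 * Real.exp (4 / 3 * a) ≤ T) :
    2 * ⌊T / (16 * Real.exp a)⌋₊ *
      (2 * √(4 / 3 * a / ⌊T / (16 * Real.exp (4 / 3 * a))⌋₊) +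
        2 / √(⌊T / (16 * Real.exp (4 / 3 * a))⌋₊ : ℝ)) ≤ 72 * √T * (1 / a) := by
  have hT : 0 < T := lt_of_lt_of_le (by positivity) h
  have h1 := exploreBound_phase_le (by linarith) h
  have h2 := floor_phase_le (a := a) hT.le
  have hs : 0 < √T := Real.sqrt_pos.2 hT
  refine (mul_le_mul (mul_le_mul_of_nonneg_left h2 zero_le_two) h1 (by positivity)
    (by positivity)).trans ?_
  have h3 : (a / 3) ^ 2 / 2 ≤ Real.exp (a / 3) := by
    have := Real.quadratic_le_exp_of_nonneg (show 0 ≤ a / 3 by linarith)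
    linarith
  have e1 : Real.exp a = Real.exp (a / 3) * Real.exp (4 / 3 * a / 2) := by
    rw [← Real.exp_add]; ring_nf
  have e2 : T = √T * √T := (Real.mul_self_sqrt hT.le).symm
  have hE := Real.exp_pos (4 / 3 * a / 2)
  have hE' := Real.exp_pos (a / 3)
  have e3 : 2 * (T / (16 * Real.exp a)) * (24 * (4 / 3 * a) * Real.exp (4 / 3 * a / 2) / √T) =
      4 * √T * (a / Real.exp (a / 3)) := by
    rw [e1]
    nth_rewrite 1 [e2]
    field_simp
    norm_num
  have h4 : a / Real.exp (a / 3) ≤ 18 * (1 / a) := by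
    rw [mul_one_div, div_le_div_iff₀ hE' (by linarith)]
    nlinarith
  rw [e3]
  nlinarith

/-- The cost of the risk of committing to the worse price. -/
theorem commit_cost_le (ha : 1 ≤ a) (h : 16 * Real.exp a ≤ T) :
    T * (Real.exp (-(⌊T / (16 * Real.exp a)⌋₊ * √(a / ⌊T / (16 * Real.exp a)⌋₊) ^ 2)) /
      √(⌊T / (16 * Real.exp a)⌋₊ : ℝ)) ≤ 12 * √T * (1 / a) := by
  have hT : 0 < T := lt_of_lt_of_le (by positivity) h
  have h1 := one_div_sqrt_floor_phase_le h
  have hn : (0 : ℝ) < ⌊T / (16 * Real.exp a)⌋₊ := by exact_mod_cast one_le_floor_phase h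
  rw [Real.sq_sqrt (by positivity), mul_div_cancel₀ _ hn.ne', div_eq_mul_one_div (Real.exp _)]
  refine (mul_le_mul_of_nonneg_left (mul_le_mul_of_nonneg_left h1 (Real.exp_pos _).le)
    hT.le).trans ?_
  have hs : 0 < √T := Real.sqrt_pos.2 hT
  have e1 : Real.exp (-a) = (Real.exp (a / 2))⁻¹ * (Real.exp (a / 2))⁻¹ := by
    rw [← Real.exp_neg, ← Real.exp_add]; ring_nf
  have e2 : T = √T * √T := (Real.mul_self_sqrt hT.le).symm
  have hE := Real.exp_pos (a / 2)
  have e3 : T * (Real.exp (-a) * (6 * Real.exp (a / 2) / √T)) =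
      6 * √T * (1 / Real.exp (a / 2)) := by
    rw [e1]
    nth_rewrite 1 [e2]
    field_simp
  have h4 : 1 / Real.exp (a / 2) ≤ 2 * (1 / a) := by
    rw [mul_one_div, div_le_div_iff₀ hE (by linarith)]
    linarith [Real.add_one_le_exp (a / 2)]
  rw [e3]
  nlinarith

end PhaseEstimates

theorem sum_one_div_pow_le (n : ℕ) :
    ∑ k ∈ Finset.range n, 1 / (4 / 3 : ℝ) ^ (n - 1 - k) ≤ 4 := by
  rw [Finset.sum_range_reflect fun j => 1 / (4 / 3 : ℝ) ^ j]
  have h : ∀ n : ℕ, ∑ k ∈ Finset.range n, 1 / (4 / 3 : ℝ) ^ k = 4 - 4 * (1 / (4 / 3 : ℝ) ^ n) := by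
    intro n
    induction n with
    | zero => simp
    | succ n ih => rw [Finset.sum_range_succ, ih, pow_succ]; field_simp; ring
  rw [h]
  have : (0 : ℝ) < 1 / (4 / 3 : ℝ) ^ n := by positivity
  linarith

theorem regret_doublyExponential_le {T J : ℕ} (M : ℕ) (p : PricePair) (ν : Demand)
    (h1 : √(T : ℝ) ≤ Real.exp ((4 / 3) ^ J)) (h2 : 16 * Real.exp ((4 / 3) ^ J) ≤ T) :
    regret T M p ν ((doublyExponential T J).policy p) ≤ 400 * √(T : ℝ) + (J + 1) * M := by
  have hT : (0 : ℝ) < T := lt_of_lt_of_le (by positivity) h2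
  have hs : 0 < √(T : ℝ) := Real.sqrt_pos.2 hT
  have hTs : √(T : ℝ) * √T = T := Real.mul_self_sqrt hT.le
  have ha1 (k : ℕ) : (1 : ℝ) ≤ (4 / 3) ^ (J - k) := one_le_pow₀ (by norm_num)
  have ha2 (k : ℕ) : 16 * Real.exp ((4 / 3) ^ (J - k)) ≤ T :=
    le_trans (mul_le_mul_of_nonneg_left (Real.exp_le_exp.2
      (pow_le_pow_right₀ (by norm_num) (Nat.sub_le J k))) (by norm_num)) h2
  have hstart : (doublyExponential T J).start (doublyExponential T J).numPhases ≤ T := by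
    have h3 : ((doublyExponential T J).start (doublyExponential T J).numPhases : ℝ) ≤
        ∑ k ∈ Finset.range (J + 1), T / 8 * (1 / (4 / 3 : ℝ) ^ (J + 1 - 1 - k)) := by
      rw [Schedule.start]
      push_cast
      refine Finset.sum_le_sum fun k _ => ?_
      refine (mul_le_mul_of_nonneg_left (floor_phase_le hT.le) zero_le_two).trans ?_
      have h4 := Real.add_one_le_exp ((4 / 3 : ℝ) ^ (J - k))
      have h5 : 1 / Real.exp ((4 / 3) ^ (J - k)) ≤ 1 / (4 / 3 : ℝ) ^ (J - k) :=
        one_div_le_one_div_of_le (by positivity) (by linarith)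
      calc 2 * ((T : ℝ) / (16 * Real.exp ((4 / 3) ^ (J - k)))) =
          T / 8 * (1 / Real.exp ((4 / 3) ^ (J - k))) := by field_simp; norm_num
        _ ≤ _ := mul_le_mul_of_nonneg_left h5 (by positivity)
    rw [← Finset.mul_sum] at h3
    have h4 := mul_le_mul_of_nonneg_left (sum_one_div_pow_le (J + 1))
      (show (0 : ℝ) ≤ T / 8 by positivity)
    have h5 : ((doublyExponential T J).start (doublyExponential T J).numPhases : ℝ) ≤ T := by
      linarith
    exact_mod_cast h5
  refine (Schedule.regret_policy_le (b := (J + 1) * M) p ν hstart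
    (fun k _ => one_le_floor_phase (ha2 k)) (fun k _ => Real.sqrt_nonneg _) fun x => ?_).trans ?_
  · have := Schedule.card_refunded_le_mul (S := doublyExponential T J) (p := p) T M x
    have h3 : ((refunded T M fun s => (doublyExponential T J).price p s x).card : ℝ) ≤
        ((J + 1 : ℕ) : ℝ) * M := by exact_mod_cast this
    push_cast at h3
    exact h3
  refine add_le_add ?_ le_rfl
  have hfirst : 2 * ((doublyExponential T J).size 0 : ℝ) * (doublyExponential T J).exploreBound 0 ≤
      √(T : ℝ) := by
    have h3 := floor_phase_le (a := (4 / 3) ^ J) hT.le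
    have h4 : (T : ℝ) / (16 * Real.exp ((4 / 3) ^ J)) ≤ √(T : ℝ) / 16 := by
      rw [div_le_div_iff₀ (by positivity) (by norm_num)]
      nlinarith
    simp only [doublyExponential, Schedule.exploreBound, Nat.sub_zero]
    linarith
  have hexp : ∑ k ∈ Finset.range (doublyExponential T J).numPhases,
      2 * ((doublyExponential T J).size k : ℝ) * (doublyExponential T J).exploreBound k ≤
      289 * √(T : ℝ) := by
    have h3 : ∑ k ∈ Finset.range J, 2 * ((doublyExponential T J).size (k + 1) : ℝ) *
        (doublyExponential T J).exploreBound (k + 1) ≤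
        ∑ k ∈ Finset.range J, 72 * √(T : ℝ) * (1 / (4 / 3 : ℝ) ^ (J - 1 - k)) := by
      refine Finset.sum_le_sum fun k hk => ?_
      rw [Finset.mem_range] at hk
      have e : (4 / 3 : ℝ) ^ (J - k) = 4 / 3 * (4 / 3) ^ (J - (k + 1)) := by
        rw [← pow_succ']
        congr 1
        omega
      have h4 := explore_cost_le (T := T) (ha1 (k + 1)) (by rw [← e]; exact ha2 k)
      rw [← e] at h4
      rw [Nat.sub_sub, Nat.add_comm 1 k]
      exact h4
    rw [← Finset.mul_sum] at h3
    have h4 := mul_le_mul_of_nonneg_left (sum_one_div_pow_le J)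
      (show (0 : ℝ) ≤ 72 * √(T : ℝ) by positivity)
    rw [show (doublyExponential T J).numPhases = J + 1 from rfl, Finset.sum_range_succ']
    linarith
  have hcommit : T * ∑ k ∈ Finset.range (doublyExponential T J).numPhases,
      Real.exp (-((doublyExponential T J).size k * (doublyExponential T J).tol k ^ 2)) /
        √((doublyExponential T J).size k : ℝ) ≤ 48 * √(T : ℝ) := by
    rw [Finset.mul_sum]
    have h3 : ∀ k ∈ Finset.range (J + 1), T *
        (Real.exp (-((doublyExponential T J).size k * (doublyExponential T J).tol k ^ 2)) /
        √((doublyExponential T J).size k : ℝ)) ≤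
        12 * √(T : ℝ) * (1 / (4 / 3 : ℝ) ^ (J + 1 - 1 - k)) := fun k _ =>
      commit_cost_le (ha1 k) (ha2 k)
    refine (Finset.sum_le_sum h3).trans ?_
    rw [← Finset.mul_sum]
    have h4 := mul_le_mul_of_nonneg_left (sum_one_div_pow_le (J + 1))
      (show (0 : ℝ) ≤ 12 * √(T : ℝ) by positivity)
    linarith
  have hlast : T * (doublyExponential T J).exploreBound (doublyExponential T J).numPhases ≤
      48 * √(T : ℝ) := by
    have h3 := exploreBound_phase_le (ha1 J) (ha2 J)
    have h4 : Real.exp (1 / 2) ≤ 2 := by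
      have h5 : Real.exp (1 / 2) ^ 2 = Real.exp 1 := by
        rw [← Real.exp_nat_mul]; norm_num
      have := Real.exp_one_lt_d9
      nlinarith [Real.exp_pos (1 / 2)]
    refine (mul_le_mul_of_nonneg_left h3 hT.le).trans ?_
    rw [Nat.sub_self, pow_zero, mul_one]
    nth_rewrite 1 [← hTs]
    have e : √(T : ℝ) * √T * (24 * Real.exp (1 / 2) / √T) = 24 * √T * Real.exp (1 / 2) := by
      field_simp
    rw [e]
    nlinarith
  rw [mul_add]
  linarith

/-- Suitable numbers of phases exist for long horizons. -/
theorem exists_doublyExponential {T : ℕ} (hT : 4096 ≤ T) :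
    ∃ J : ℕ, √(T : ℝ) ≤ Real.exp ((4 / 3) ^ J) ∧ 16 * Real.exp ((4 / 3) ^ J) ≤ T ∧
      (J + 1 : ℝ) ≤ 6 * Real.log (Real.log T) := by
  have hT' : (4096 : ℝ) ≤ T := by exact_mod_cast hT
  have hT0 : (0 : ℝ) < T := by linarith
  set l := Real.log T with hl
  have hexp : Real.exp l = T := Real.exp_log hT0
  have h2 := Real.log_two_gt_d9
  have hl12 : 12 * Real.log 2 ≤ l := by
    have h : Real.log ((2 : ℝ) ^ 12) ≤ l := Real.log_le_log (by norm_num) (by norm_num; linarith)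
    rw [Real.log_pow] at h
    exact_mod_cast h
  have h16 : (16 : ℝ) = Real.exp (4 * Real.log 2) := by
    rw [show 4 * Real.log 2 = Real.log (2 ^ 4) by rw [Real.log_pow]; norm_num,
      Real.exp_log (by norm_num)]
    norm_num
  have hsqrt : √(T : ℝ) = Real.exp (l / 2) := by
    rw [← hexp, Real.sqrt_eq_rpow, ← Real.exp_mul]
    ring_nf
  have hll : 1 ≤ Real.log l := by
    rw [Real.le_log_iff_exp_le (by linarith)]
    have := Real.exp_one_lt_d9
    linarith
  -- The least `J` with `√T ≤ exp ((4 / 3) ^ J)` is taken.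
  have hex : ∃ J : ℕ, l / 2 ≤ (4 / 3 : ℝ) ^ J :=
    (pow_unbounded_of_one_lt (l / 2) (by norm_num)).imp fun _ h => h.le
  classical
  have hJ := Nat.find_spec hex
  have hmin := fun m => Nat.find_min (m := m) hex
  generalize Nat.find hex = J at hJ hmin
  refine ⟨J, ?_, ?_, ?_⟩
  · rw [hsqrt]
    exact Real.exp_le_exp.2 hJ
  · rw [h16, ← hexp, ← Real.exp_add]
    refine Real.exp_le_exp.2 ?_
    rcases J with _ | J
    · rw [pow_zero]; linarith
    · have := hmin J (Nat.lt_succ_self J)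
      rw [pow_succ]
      linarith
  · rcases J with _ | J
    · push_cast; linarith
    · have h3 := not_le.1 (hmin J (Nat.lt_succ_self J))
      have h4 : J * Real.log (4 / 3) ≤ Real.log l := by
        rw [← Real.log_pow]
        exact Real.log_le_log (by positivity) (by linarith)
      have h5 : 1 / 4 ≤ Real.log (4 / 3) := by
        have := Real.one_sub_inv_le_log_of_pos (show (0 : ℝ) < 4 / 3 by norm_num)
        norm_num at this ⊢
        linarith
      have h6 : (0 : ℝ) ≤ J := Nat.cast_nonneg J
      push_cast
      nlinarith

theorem log_log_pos {T : ℕ} (hT : 3 ≤ T) : 0 < Real.log (Real.log T) := by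
  have hT' : (3 : ℝ) ≤ T := by exact_mod_cast hT
  refine Real.log_pos ?_
  rw [Real.lt_log_iff_exp_lt (by linarith)]
  have := Real.exp_one_lt_d9
  linarith

theorem optRegret_le_sqrt_add {T : ℕ} (M : ℕ) (hT : 3 ≤ T) :
    optRegret T M ≤ 400 * (√(T : ℝ) + M * Real.log (Real.log T)) := by
  have hll := log_log_pos hT
  have hM : (0 : ℝ) ≤ M := Nat.cast_nonneg M
  have hML := mul_nonneg hM hll.le
  rcases lt_or_ge T 4096 with h | h
  · refine (optRegret_le_horizon T M).trans ?_
    have h1 : √(T : ℝ) ≤ 64 := Real.sqrt_le_iff.2 ⟨by norm_num, by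
      have : (T : ℝ) < 4096 := by exact_mod_cast h
      norm_num; linarith⟩
    have h2 := Real.mul_self_sqrt (Nat.cast_nonneg (α := ℝ) T)
    nlinarith [Real.sqrt_nonneg (T : ℝ)]
  · obtain ⟨J, h1, h2, h3⟩ := exists_doublyExponential h
    refine optRegret_le _ fun p ν => (regret_doublyExponential_le M p ν h1 h2).trans ?_
    have := mul_le_mul_of_nonneg_right h3 hM
    nlinarith

end PriceProtection

theorem mainTheorem1 :
    (∃ c C : ℝ, 0 < c ∧ 0 < C ∧ ∀ T M : ℕ, 3 ≤ T →
      c * (√(T : ℝ) + min (M : ℝ) ((T : ℝ) ^ (2 / 3 : ℝ))) ≤ PriceProtection.optRegret T M ∧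
      PriceProtection.optRegret T M ≤
        C * (√(T : ℝ) + min ((M : ℝ) * Real.log (Real.log T)) ((T : ℝ) ^ (2 / 3 : ℝ)))) ∧
    (∀ κ : ℝ, 0 < κ → ∃ c C : ℝ, 0 < c ∧ 0 < C ∧ ∀ T M : ℕ, 3 ≤ T →
      (M : ℝ) ≤ κ * √(T : ℝ) →
      c * √(T : ℝ) ≤ PriceProtection.optRegret T M ∧
      PriceProtection.optRegret T M ≤ C * (√(T : ℝ) * Real.log (Real.log T))) ∧
    (∀ κ₁ κ₂ : ℝ, 0 < κ₁ → 0 < κ₂ → ∃ c C : ℝ, 0 < c ∧ 0 < C ∧ ∀ T M : ℕ, 3 ≤ T →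
      κ₁ * √(T : ℝ) ≤ (M : ℝ) → (M : ℝ) ≤ κ₂ * (T : ℝ) ^ (2 / 3 : ℝ) →
      c * (M : ℝ) ≤ PriceProtection.optRegret T M ∧
      PriceProtection.optRegret T M ≤ C * ((M : ℝ) * Real.log (Real.log T))) ∧
    (∀ κ : ℝ, 0 < κ → ∃ c C : ℝ, 0 < c ∧ 0 < C ∧ ∀ T M : ℕ, 3 ≤ T →
      κ * (T : ℝ) ^ (2 / 3 : ℝ) ≤ (M : ℝ) →
      c * (T : ℝ) ^ (2 / 3 : ℝ) ≤ PriceProtection.optRegret T M ∧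
      PriceProtection.optRegret T M ≤ C * (T : ℝ) ^ (2 / 3 : ℝ)) := by
  have hlow {T M : ℕ} (hT : 3 ≤ T) := PriceProtection.min_le_optRegret (T := T) (M := M) hT
  have hsqrt {T M : ℕ} (hT : 3 ≤ T) := PriceProtection.sqrt_le_optRegret (T := T) (M := M) hT
  have hup {T : ℕ} (M : ℕ) (hT : 3 ≤ T) := PriceProtection.optRegret_le_sqrt_add M hT
  have hup' {T : ℕ} (M : ℕ) (hT : 3 ≤ T) := PriceProtection.optRegret_le_rpow M hT
  -- As `T ≥ 3`, the iterated logarithm is bounded away from `0`, so that `√T` is absorbed.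
  set lam : ℝ := Real.log (Real.log (3 : ℕ)) with hlam
  have hlam0 : 0 < lam := PriceProtection.log_log_pos le_rfl
  have hlamT {T : ℕ} (hT : 3 ≤ T) : lam ≤ Real.log (Real.log T) := by
    have h3 : (0 : ℝ) < Real.log (3 : ℕ) := Real.log_pos (by norm_num)
    refine Real.log_le_log h3 (Real.log_le_log (by norm_num) (by exact_mod_cast hT))
  have hone {T : ℕ} (hT : 3 ≤ T) : 1 ≤ 1 / lam * Real.log (Real.log T) := by
    rw [one_div_mul_eq_div, le_div_iff₀ hlam0, one_mul]
    exact hlamT hT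
  refine ⟨⟨1 / 18432, 400, by norm_num, by norm_num, fun T M hT => ⟨?_, ?_⟩⟩, fun κ hκ =>
    ⟨1 / 192, 400 * (1 / lam + κ), by norm_num, by positivity, fun T M hT hM => ⟨?_, ?_⟩⟩,
    fun κ₁ κ₂ h₁ h₂ => ⟨min 1 (1 / κ₂) / 9216, 400 * (1 / κ₁ * (1 / lam) + 1), by positivity,
      by positivity, fun T M hT hM₁ hM₂ => ⟨?_, ?_⟩⟩,
    fun κ hκ => ⟨min κ 1 / 9216, 8, by positivity, by norm_num, fun T M hT hM => ⟨?_, hup' M hT⟩⟩⟩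
  · have h1 := hlow (M := M) hT
    have h2 := hsqrt (M := M) hT
    have h3 := Real.sqrt_nonneg (T : ℝ)
    linarith
  · rcases min_cases ((M : ℝ) * Real.log (Real.log T)) ((T : ℝ) ^ (2 / 3 : ℝ)) with h | h <;>
      rw [h.1]
    · exact hup M hT
    · have h1 := hup' M hT
      have h2 : 0 ≤ (T : ℝ) ^ (2 / 3 : ℝ) := by positivity
      have h3 := Real.sqrt_nonneg (T : ℝ)
      linarith
  · have h2 := hsqrt (M := M) hT
    linarith
  · have h1 := hup M hT
    have h2 := mul_le_mul_of_nonneg_left (hone hT) (Real.sqrt_nonneg (T : ℝ))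
    have h3 := mul_le_mul_of_nonneg_right hM (PriceProtection.log_log_pos hT).le
    linarith
  · have h1 : min 1 (1 / κ₂) * (M : ℝ) ≤ min (M : ℝ) ((T : ℝ) ^ (2 / 3 : ℝ)) := by
      have hM0 : (0 : ℝ) ≤ M := Nat.cast_nonneg M
      refine le_min ?_ ?_
      · exact mul_le_of_le_one_left hM0 (min_le_left _ _)
      · refine (mul_le_mul_of_nonneg_right (min_le_right _ _) hM0).trans ?_
        rw [one_div_mul_eq_div, div_le_iff₀ h₂]
        linarith
    have h2 := hlow (M := M) hT
    linarith
  · have h1 := hup M hT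
    have hM0 : (0 : ℝ) ≤ M := Nat.cast_nonneg M
    have h2 : √(T : ℝ) ≤ 1 / κ₁ * M := by
      rw [one_div_mul_eq_div, le_div_iff₀ h₁]
      linarith
    have h3 := mul_le_mul_of_nonneg_left (hone hT) (show 0 ≤ 1 / κ₁ * (M : ℝ) by positivity)
    linarith
  · have h1 : min κ 1 * (T : ℝ) ^ (2 / 3 : ℝ) ≤ min (M : ℝ) ((T : ℝ) ^ (2 / 3 : ℝ)) := by
      have h0 : 0 ≤ (T : ℝ) ^ (2 / 3 : ℝ) := by positivity
      refine le_min ?_ (mul_le_of_le_one_left h0 (min_le_right _ _))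
      exact (mul_le_mul_of_nonneg_right (min_le_left _ _) h0).trans hM
    have h2 := hlow (M := M) hT
    linarith
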